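/- Let $E$ be a Hermitian vector space of complex dimension $n$ with a complete flag $E=W_0\supset W_1\supset\dots\supset W_n=\{0\}$, $\dim W_m=n-m$. For $1\le i\le n$ let $E_i$ be the orthogonal complement of $W_i$ in $W_{i-1}$ and let $A=\bigoplus_{i=1}^n i\,\mathrm{id}_{E_i}$. On the unitary group $\mathcal U(E)\subset \mathrm{End}(E)$ consider the flow of the vector field $U\mapsto A-UAU$, which is the gradient of the Morse–Smale function $f(U)=\mathrm{Re}\,\mathrm{Tr}(AU)$ with respect to the bi-invariant metric $\langle X,Y\rangle=\tfrac12\mathrm{Re}\,\mathrm{Tr}(X^*Y)$. For $I\subset\{1,\dots,n\}$ let $U_I$ be the critical point equal to $-1$ on $\bigoplus_{i\in I}E_i$ and to $1$ on its orthogonal complement, and let $U(U_I)$ be its unstable manifold, i.e. the set of all $U\in\mathcal U(E)$ whose flow line tends to $U_I$ as $t\to-\infty$. For $1\le k\le n$ let $$\mathrm{Tc}_k(\tilde U,d)=\Big(\frac{i}{2\pi}\Big)^k\frac{[(k-1)!]^2}{(2k-1)!}\,\mathrm{tr}\big(\wedge^{2k-1}g^{-1}dg\big),$$ a form of degree $2k-1$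 on $\mathcal U(E)$. Let $1\le k\le n$ and $I\subset\{1,\dots,n\}$ with $I\ne\{k\}$. Then $U(U_I)$ is an orientable embedded smooth submanifold of dimension $\sum_{i\in I}(2i-1)$, and for every orientation of it the form $\mathrm{Tc}_k(\tilde U,d)$ is absolutely integrable over $U(U_I)$ and $$\int_{U(U_I)}\mathrm{Tc}_k(\tilde U,d)=0 ,$$ where, as usual, the integral of a form of degree $2k-1$ over a manifold of dimension different from $2k-1$ is $0$. -/

import Mathlib

open scoped ContDiff Topology
open MeasureTheory Filter

noncomputable section

namespace UnstableIntegral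

/-! ### Integration of differential forms over oriented embedded submanifolds -/

section Integration

variable {V : Type*} [NormedAddCommGroup V] [NormedSpace ℝ V]

/-- A smooth local parametrization of the subset `M` of the real normed space `V` by an open subset
of `ℝ ^ d`: an injective immersion which is a homeomorphism onto a relatively open subset of `M`. -/
structure Param (M : Set V) (d : ℕ) where
  /-- the map -/
  toFun : (Fin d → ℝ) → V
  /-- its domain -/
  source : Set (Fin d → ℝ)
  isOpen_source : IsOpen source
  contDiffOn : ContDiffOn ℝ ∞ toFun source
  injOn : Set.InjOn toFun source
  injective_fderiv : ∀ x ∈ source, Function.Injective (fderiv ℝ toFun x)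
  image_open : ∀ S ⊆ source, IsOpen S → ∃ O : Set V, IsOpen O ∧ toFun '' S = M ∩ O

/-- Two local parametrizations define the same orientation where their images overlap: at each
common point the Jacobian determinant of the transition map is positive. -/
def Param.SameOrientation {M : Set V} {d : ℕ} (f g : Param M d) : Prop :=
  ∀ x ∈ f.source, ∀ y ∈ g.source, f.toFun x = g.toFun y →
    ∃ L : (Fin d → ℝ) →ₗ[ℝ] (Fin d → ℝ), 0 < LinearMap.det L ∧
      ∀ v, fderiv ℝ f.toFun x v = fderiv ℝ g.toFun y (L v)

/-- An orientation of `M` as a `d`-dimensional embedded smooth submanifold of `V`, given by an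
oriented atlas.  The existence of one says that `M` is an orientable embedded smooth submanifold
of dimension `d`. -/
structure OrientedAtlas (M : Set V) (d : ℕ) where
  /-- the local parametrizations of the atlas -/
  charts : Set (Param M d)
  covers : ∀ p ∈ M, ∃ f ∈ charts, p ∈ f.toFun '' f.source
  compatible : ∀ f ∈ charts, ∀ g ∈ charts, f.SameOrientation g

/-- The positively oriented local parametrizations. -/
def OrientedAtlas.IsPositive {M : Set V} {d : ℕ} (o : OrientedAtlas M d) (f : Param M d) : Prop :=
  ∀ g ∈ o.charts, f.SameOrientation g

/-- A countable partition of `M` into measurable pieces, each one lying in the image of a positively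
oriented local parametrization. -/
structure OrientedPartition {M : Set V} {d : ℕ} (o : OrientedAtlas M d) where
  /-- the parametrization used for each piece -/
  chart : ℕ → Param M d
  /-- the pieces, in the coordinates of the parametrizations -/
  piece : ℕ → Set (Fin d → ℝ)
  isPositive : ∀ i, o.IsPositive (chart i)
  measurableSet_piece : ∀ i, MeasurableSet (piece i)
  piece_subset : ∀ i, piece i ⊆ (chart i).source
  disjoint : ∀ i j, i ≠ j → Disjoint ((chart i).toFun '' piece i) ((chart j).toFun '' piece j)
  covers : ⋃ i, (chart i).toFun '' piece i = M

/-- The function `h` with `f^* η = h dx₁ ∧ ⋯ ∧ dx_d`, for a differential form `η` of degree `d`.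
A form whose degree `p` is not `d` has no component of degree `d`, so `h = 0` then. -/
def pullbackCoeff {p d : ℕ} (η : V → V [⋀^Fin p]→ₗ[ℝ] ℂ) (f : (Fin d → ℝ) → V)
    (x : Fin d → ℝ) : ℂ :=
  if h : p = d then
    η (f x) (fun i => fderiv ℝ f x (Pi.single (Fin.cast h i) 1))
  else 0

/-- The differential form `η` is absolutely integrable over the oriented submanifold `M` and its
integral is `c`: for every countable partition of `M` into measurable pieces lying in positively
oriented coordinate patches (and there is such a partition), the integrals of `|η|` over the pieces
are finite and have a finite sum, and the integrals of `η` over the pieces sum to `c`. -/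
def HasFormIntegral {M : Set V} {d p : ℕ} (o : OrientedAtlas M d)
    (η : V → V [⋀^Fin p]→ₗ[ℝ] ℂ) (c : ℂ) : Prop :=
  Nonempty (OrientedPartition o) ∧
  ∀ P : OrientedPartition o,
    (∀ i, IntegrableOn (pullbackCoeff η (P.chart i).toFun) (P.piece i)) ∧
    (Summable fun i => ∫ x in P.piece i, ‖pullbackCoeff η (P.chart i).toFun x‖) ∧
    HasSum (fun i => ∫ x in P.piece i, pullbackCoeff η (P.chart i).toFun x) c

end Integration

/-! ### The flow on the unitary group and the forms `Tc_k` -/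

section Unitary

variable {E : Type*} [NormedAddCommGroup E] [InnerProductSpace ℂ E] [CompleteSpace E]
  [FiniteDimensional ℂ E]

/-- A complete flag `E = W 0 ⊃ W 1 ⊃ ⋯ ⊃ W n = 0`, where `n = dim E`; also `W m = 0` for `n < m`. -/
structure CompleteFlag (E : Type*) [NormedAddCommGroup E] [InnerProductSpace ℂ E] where
  /-- the subspaces -/
  W : ℕ → Submodule ℂ E
  antitone : Antitone W
  finrank_add : ∀ m ≤ Module.finrank ℂ E, Module.finrank ℂ (W m) + m = Module.finrank ℂ E

/-- The orthogonal complement `E i` of `W i` in `W (i - 1)`, for `1 ≤ i`. -/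
def CompleteFlag.line (F : CompleteFlag E) (i : ℕ) : Submodule ℂ E :=
  (F.W i)ᗮ ⊓ F.W (i - 1)

/-- The self-adjoint operator `A = ⨁ i • id_{E i}`, over `1 ≤ i ≤ n`. -/
def CompleteFlag.A (F : CompleteFlag E) : E →L[ℂ] E :=
  ∑ i ∈ Finset.Icc 1 (Module.finrank ℂ E), (i : ℂ) • (F.line i).starProjection

/-- The vector field `U ↦ A - U A U`, which on the unitary group is the gradient of
`U ↦ Re (Tr (A U))` with respect to the bi-invariant metric `⟨X, Y⟩ = Re (Tr (X^* Y)) / 2`. -/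
def CompleteFlag.field (F : CompleteFlag E) (U : E →L[ℂ] E) : E →L[ℂ] E :=
  F.A - U * F.A * U

/-- The critical point `U_I`: it is `-1` on the sum of the lines `E i`, `i ∈ I`, and `1` on the
orthogonal complement. -/
def CompleteFlag.critPoint (F : CompleteFlag E) (I : Finset ℕ) : E →L[ℂ] E :=
  1 - (2 : ℂ) • ∑ i ∈ I, (F.line i).starProjection

/-- The unstable manifold of `U_I`: the unitary operators through which there passes a flow line
in the unitary group that tends to `U_I` as `t → -∞`. -/
def CompleteFlag.unstableManifold (F : CompleteFlag E) (I : Finset ℕ) : Set (E →L[ℂ] E) :=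
  {U | ∃ γ : ℝ → E →L[ℂ] E,
    (∀ t, γ t ∈ unitary (E →L[ℂ] E)) ∧
    (∀ t, HasDerivAt γ (F.field (γ t)) t) ∧
    γ 0 = U ∧
    Tendsto γ atBot (𝓝 (F.critPoint I))}

/-- The trace of endomorphisms of `E`, as a real linear map. -/
def traceR (E : Type*) [NormedAddCommGroup E] [InnerProductSpace ℂ E] : (E →L[ℂ] E) →ₗ[ℝ] ℂ :=
  (LinearMap.trace ℂ E ∘ₗ ContinuousLinearMap.coeLM ℂ).restrictScalars ℝ

/-- The `p`-form `tr (⋀^p g⁻¹ dg)` on the unitary group of `E`, where `g⁻¹ = g^*`: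
`(v₁, …, v_p) ↦ ∑ σ, sign σ • tr (g⁻¹ v_{σ 1} ⋯ g⁻¹ v_{σ p})`. -/
def maurerCartanTrace (E : Type*) [NormedAddCommGroup E] [InnerProductSpace ℂ E] [CompleteSpace E]
    (p : ℕ) (g : E →L[ℂ] E) : (E →L[ℂ] E) [⋀^Fin p]→ₗ[ℝ] ℂ :=
  MultilinearMap.alternatization
    ((traceR E).compMultilinearMap
      ((MultilinearMap.mkPiAlgebraFin ℝ p (E →L[ℂ] E)).compLinearMap
        fun _ => LinearMap.mulLeft ℝ (star g)))

/-- The transgression form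
`Tc_k = (i / 2π) ^ k * ((k - 1)!) ^ 2 / (2 k - 1)! * tr (⋀^(2 k - 1) g⁻¹ dg)`, for `1 ≤ k`. -/
def Tc (E : Type*) [NormedAddCommGroup E] [InnerProductSpace ℂ E] [CompleteSpace E]
    (k : ℕ) (g : E →L[ℂ] E) : (E →L[ℂ] E) [⋀^Fin (2 * k - 1)]→ₗ[ℝ] ℂ :=
  ((Complex.I / (2 * Real.pi)) ^ k * (((k - 1).factorial : ℂ) ^ 2 / ((2 * k - 1).factorial : ℂ))) •
    maurerCartanTrace E (2 * k - 1) g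

end Unitary

end UnstableIntegral

end

/-! The pullback of `Tc E k` to the unstable manifold vanishes at every point. If 2k-1 differs from
the dimension, this is the convention in `pullbackCoeff`. Otherwise let r be the largest element of
I. The equation ∑ (2i-1) = 2k-1 together with I ≠ {k} forces r < k (`card_filter_le_lt`). Every U in
the unstable manifold fixes the lines E_i with i > r, so in a basis adapted to the flag g⁻¹dg has
nonzero rows only among the first r ≤ k-1 (`pullbackCoeff_Tc_eq_zero`). The alternating trace of
2m+1 matrices with at most m nonzero rows is zero, which is used with m = k-1
(`sum_sign_trace_prod_eq_zero`).

That trace identity comes from the pigeonhole principle: antisymmetrizing m+1 indices which take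
only m values gives zero. The antisymmetrization is a sum over permutations σ of m+1 points, each
contributing a product of traces of words. If σ is not a full cycle, some word has even length and
the alternating sum kills the term. The full cycles all contribute the same signed amount, so this
amount is zero.

The geometry rests on a global chart of the unstable manifold. Let P be the projection to ⨁_{i ∈ I}
E_i. A point is written U = 1 - B K⁻¹ B^* with K = B^*B/2 + H + (1 - P), where B is in reduced
echelon form with pivots in I and H is skew-Hermitian and supported on the range of P. In these
coordinates the flow is linear: B ↦ e^{-tA} B e^{tA}, H ↦ e^{tA} H e^{tA} (`hasDerivAt_cellPoint`),
and it tends to (P, 0) as t → -∞. Conversely, an explicit solution of the Riccati flow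
(`flow_mul_eq`) shows that backward convergence to U_I forces the leading coordinates of the range
of 1 - U to lie in I (`exists_mem_entry_ne_zero`), and column reduction then produces B and H
(`mem_range_cellMap_of_flowLine`). -/

noncomputable section

namespace UnstableIntegral

local notation "⟪" x ", " y "⟫" => inner ℂ x y

/-! ### Vanishing of alternating traces of matrices of small size -/

section AlternatingTrace

open Equiv Equiv.Perm

variable {α ι : Type*} [Fintype α] [DecidableEq α] [Fintype ι]

/-- The product of traces of words in the matrices `A a`, one word for each cycle of `s`. -/
def cycleTrace (s : Perm α) (A : α → Matrix ι ι ℂ) : ℂ :=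
  ∑ h : α → ι, ∏ a, A a (h a) (h (s a))

/-- The antisymmetrization of `cycleTrace`. -/
def altTrace (s : Perm α) (A : α → Matrix ι ι ℂ) : ℂ :=
  ∑ τ : Perm α, sign τ • cycleTrace s (A ∘ τ)

lemma cycleTrace_comp {β : Type*} [Fintype β] [DecidableEq β] (s : Perm β)
    (A : α → Matrix ι ι ℂ) (τ : β ≃ α) :
    cycleTrace s (A ∘ τ) = cycleTrace ((τ.symm.trans s).trans τ) A := by
  unfold cycleTrace
  refine Fintype.sum_equiv (Equiv.arrowCongr τ (Equiv.refl ι)) _ _ fun h => ?_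
  refine Fintype.prod_equiv τ _ _ fun a => ?_
  simp

lemma altTrace_eq (s : Perm α) (A : α → Matrix ι ι ℂ) :
    altTrace s A = ∑ τ : Perm α, sign τ • cycleTrace (τ * s * τ⁻¹) A :=
  Finset.sum_congr rfl fun τ _ => by rw [cycleTrace_comp]; rfl

/-- Conjugating `s` by π only reindexes the sum over τ by τ ↦ τπ, which costs the sign of π. -/
lemma altTrace_conj (s π : Perm α) (A : α → Matrix ι ι ℂ) :
    altTrace (π * s * π⁻¹) A = sign π • altTrace s A := by
  rw [altTrace_eq, altTrace_eq, Finset.smul_sum]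
  refine Fintype.sum_equiv (Equiv.mulRight π) _ _ fun τ => ?_
  rw [Equiv.coe_mulRight, smul_smul, Perm.sign_mul, mul_left_comm, Int.units_mul_self, mul_one]
  have : τ * (π * s * π⁻¹) * τ⁻¹ = τ * π * s * (τ * π)⁻¹ := by group
  rw [this]

/-- Conjugation by `c` fixes `s` but changes the sign of the alternating trace. This is the reason
why the trace of a word of even length antisymmetrizes to zero. -/
lemma altTrace_eq_zero_of_commute {s c : Perm α} (hc : sign c = -1) (h : Commute c s)
    (A : α → Matrix ι ι ℂ) : altTrace s A = 0 := by
  have h1 := altTrace_conj s c A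
  rw [hc, h.eq, mul_inv_cancel_right] at h1
  rw [Units.smul_def] at h1
  simp only [Units.val_neg, Units.val_one, neg_smul, one_smul] at h1
  exact self_eq_neg.mp h1

/-- Pigeonhole: a labelling `h` with values in `S` takes the same value at two points b, b' of β.
Composing σ with the transposition of b and b' leaves each product unchanged and flips the sign. A
labelling with a value outside `S` meets a zero row. -/
lemma sum_sign_cycleTrace_eq_zero {β γ : Type*} [Fintype β] [DecidableEq β] [Fintype γ]
    [DecidableEq γ] (s : Perm (β ⊕ γ)) (A : β ⊕ γ → Matrix ι ι ℂ) (S : Finset ι)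
    (hS : S.card < Fintype.card β) (hA : ∀ a, ∀ i ∉ S, ∀ j, A a i j = 0) :
    ∑ σ : Perm β, sign σ • cycleTrace (Perm.sumCongr σ 1 * s) A = 0 := by
  simp only [cycleTrace, Finset.smul_sum]
  rw [Finset.sum_comm]
  refine Finset.sum_eq_zero fun h _ => ?_
  by_cases hh : ∃ a, h a ∉ S
  · obtain ⟨a, ha⟩ := hh
    refine Finset.sum_eq_zero fun σ _ => ?_
    rw [Finset.prod_eq_zero (Finset.mem_univ a) (hA a _ ha _), smul_zero]
  push Not at hh
  obtain ⟨b, -, b', -, hne, hbb⟩ := Finset.exists_ne_map_eq_of_card_lt_of_maps_to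
    (s := Finset.univ) (t := S) (f := fun b : β => h (Sum.inl b)) (by simpa using hS)
    (fun b _ => hh _)
  have hsw : ∀ x : β ⊕ γ, h (Perm.sumCongr (swap b b') 1 x) = h x := by
    rintro (x | x)
    · simp only [Perm.sumCongr_apply, Sum.map_inl, swap_apply_def]
      split_ifs with h1 h2
      · rw [h1]; exact hbb.symm
      · rw [h2]; exact hbb
      · rfl
    · exact congrArg h (by rw [Perm.sumCongr_apply]; rfl)
  have key : (∑ σ : Perm β, sign σ • ∏ a, A a (h a) (h ((Perm.sumCongr σ (1 : Perm γ) * s : Perm (β ⊕ γ)) a))) =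
      -∑ σ : Perm β, sign σ • ∏ a, A a (h a) (h ((Perm.sumCongr σ (1 : Perm γ) * s : Perm (β ⊕ γ)) a)) := by
    rw [← Finset.sum_neg_distrib]
    refine Fintype.sum_equiv (Equiv.mulLeft (swap b b')) _ _ fun σ => ?_
    rw [Equiv.coe_mulLeft, Perm.sign_mul, sign_swap hne, neg_one_mul, Units.smul_def, Units.smul_def]
    rw [Units.val_neg, neg_smul, neg_neg]
    congr 1
    refine Finset.prod_congr rfl fun a _ => ?_
    have : Perm.sumCongr (swap b b' * σ) (1 : Perm γ) = Perm.sumCongr (swap b b') 1 * Perm.sumCongr σ 1 := by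
      rw [Perm.sumCongr_mul, one_mul]
    rw [this, mul_assoc, mul_apply (Perm.sumCongr (swap b b') 1), hsw]
  exact self_eq_neg.mp key

/-! ### Permutations made of m blocks of length two and one block of length one -/

/-- Exchange `some j` and `j` for `j ∈ C`. -/
def swapOn {m : ℕ} (C : Finset (Fin m)) : Perm (Option (Fin m) ⊕ Fin m) :=
  Function.Involutive.toPerm
    (fun x => match x with
      | Sum.inl none => Sum.inl none
      | Sum.inl (some j) => if j ∈ C then Sum.inr j else Sum.inl (some j)
      | Sum.inr j => if j ∈ C then Sum.inl (some j) else Sum.inr j)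
    (by
      rintro ((_ | j) | j)
      · rfl
      · by_cases h : j ∈ C <;> simp [h]
      · by_cases h : j ∈ C <;> simp [h])

@[simp] lemma swapOn_none {m : ℕ} (C : Finset (Fin m)) :
    swapOn C (Sum.inl none) = Sum.inl none := rfl

@[simp] lemma swapOn_some {m : ℕ} (C : Finset (Fin m)) (j : Fin m) :
    swapOn C (Sum.inl (some j)) = if j ∈ C then Sum.inr j else Sum.inl (some j) := rfl

@[simp] lemma swapOn_inr {m : ℕ} (C : Finset (Fin m)) (j : Fin m) :
    swapOn C (Sum.inr j) = if j ∈ C then Sum.inl (some j) else Sum.inr j := rfl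

lemma sign_swapOn {m : ℕ} (C : Finset (Fin m)) : sign (swapOn C) = (-1) ^ C.card := by
  induction C using Finset.induction_on with
  | empty =>
    have : swapOn (∅ : Finset (Fin m)) = 1 := by
      ext1 x; rcases x with ((_ | j) | j) <;> simp
    rw [this]; simp
  | insert a C ha ih =>
    have : swapOn (insert a C) = swap (Sum.inl (some a)) (Sum.inr a) * swapOn C := by
      ext1 x
      rcases x with ((_ | j) | j)
      · simp [swap_apply_def]
      · by_cases hj : j = a
        · subst hj; simp [ha]
        · by_cases hC : j ∈ C <;> simp [hj, hC, swap_apply_def]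
      · by_cases hj : j = a
        · subst hj; simp [ha]
        · by_cases hC : j ∈ C <;> simp [hj, hC, swap_apply_def]
    rw [this, Perm.sign_mul, ih, sign_swap (by simp), Finset.card_insert_of_notMem ha, pow_succ']

/-- The permutation which moves through the blocks `some j, j` and then applies `σ` to the first
elements of the blocks. -/
def blockPerm {m : ℕ} (σ : Perm (Option (Fin m))) : Perm (Option (Fin m) ⊕ Fin m) :=
  Perm.sumCongr σ 1 * swapOn Finset.univ

@[simp] lemma blockPerm_none {m : ℕ} (σ : Perm (Option (Fin m))) :
    blockPerm σ (Sum.inl none) = Sum.inl (σ none) := rfl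

@[simp] lemma blockPerm_some {m : ℕ} (σ : Perm (Option (Fin m))) (j : Fin m) :
    blockPerm σ (Sum.inl (some j)) = Sum.inr j := by simp [blockPerm]

@[simp] lemma blockPerm_inr {m : ℕ} (σ : Perm (Option (Fin m))) (j : Fin m) :
    blockPerm σ (Sum.inr j) = Sum.inl (σ (some j)) := by simp [blockPerm]

/-- Only `none` is a block of length one, so a cycle of σ avoiding it lifts to a cycle of `blockPerm
σ` of even length. That cycle is an odd permutation commuting with `blockPerm σ`. -/
lemma altTrace_blockPerm_eq_zero {m : ℕ} (σ : Perm (Option (Fin m))) (j : Fin m)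
    (hj : ¬ σ.SameCycle (some j) none) (A : Option (Fin m) ⊕ Fin m → Matrix ι ι ℂ) :
    altTrace (blockPerm σ) A = 0 := by
  classical
  set C : Finset (Fin m) := Finset.univ.filter fun i => σ.SameCycle (some j) (some i) with hC
  set c := σ.cycleOf (some j) with hc
  have hmem : ∀ i, i ∈ C ↔ σ.SameCycle (some j) (some i) := fun i => by simp [hC]
  have hcn : c none = none := by rw [hc, cycleOf_apply, if_neg hj]
  have hc1 : ∀ i ∈ C, c (some i) = σ (some i) := fun i hi => by
    rw [hc, cycleOf_apply, if_pos ((hmem i).1 hi)]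
  have hc2 : ∀ i ∉ C, c (some i) = some i := fun i hi => by
    rw [hc, cycleOf_apply, if_neg (fun h => hi ((hmem i).2 h))]
  -- The cycle of `blockPerm σ` lying over the cycle `C` of σ; it fixes everything else.
  set t := Perm.sumCongr c 1 * swapOn C with ht
  have hst : ∀ x, σ.SameCycle (some j) x → ∃ i ∈ C, σ x = some i := by
    intro x hx
    have hx' : σ.SameCycle (some j) (σ x) := sameCycle_apply_right.2 hx
    rcases hσ : σ x with _ | i
    · rw [hσ] at hx'; exact absurd hx' hj
    · exact ⟨i, (hmem i).2 (hσ ▸ hx'), rfl⟩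
  refine altTrace_eq_zero_of_commute (c := t) ?_ ?_ A
  · rw [ht, Perm.sign_mul, sign_sumCongr, Perm.sign_one, mul_one, sign_swapOn]
    -- A fixed point is treated apart because `cycleOf` is then the identity and not a cycle; here
    -- `t` is a single transposition.
    by_cases hfix : σ (some j) = some j
    · have : c = 1 := by rw [hc, cycleOf_eq_one_iff]; exact hfix
      have hC1 : C = {j} := by
        ext i
        rw [hmem, Finset.mem_singleton]
        constructor
        · intro h
          have := h.eq_of_left hfix
          simpa using this.symm
        · rintro rfl; exact SameCycle.refl _ _
      rw [this, hC1]; simp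
    · rw [IsCycle.sign (isCycle_cycleOf σ hfix)]
      have : (σ.cycleOf (some j)).support = C.map Function.Embedding.some := by
        ext x
        rw [mem_support_cycleOf_iff' hfix]
        rcases x with _ | i
        · simpa using hj
        · simp [hmem]
      rw [this, Finset.card_map, neg_mul, ← pow_add, Even.neg_one_pow ⟨_, rfl⟩]
  · ext1 x
    rw [Perm.mul_apply (f := t), Perm.mul_apply (g := t)]
    rcases x with ((_ | i) | i)
    · have h2 : t (Sum.inl none) = Sum.inl none := by simp [ht, hcn]
      rw [h2, blockPerm_none]
      rcases hσ : σ none with _ | i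
      · exact h2
      · have hi : i ∉ C := by
          rw [hmem, ← hσ, sameCycle_apply_right]; exact hj
        simp [ht, hi, hc2 i hi]
    · by_cases hi : i ∈ C
      · simp [ht, hi, hc1 i hi]
      · simp [ht, hi, hc2 i hi]
    · by_cases hi : i ∈ C
      · obtain ⟨i', hi', hσ⟩ := hst _ ((hmem i).1 hi)
        simp [ht, hi, hc1 i hi, hσ, hi']
      · have h2 : t (Sum.inr i) = Sum.inr i := by simp [ht, hi]
        rw [h2, blockPerm_inr]
        rcases hσ : σ (some i) with _ | i'
        · simp [ht, hcn]
        · have hi' : i' ∉ C := by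
            rw [hmem, ← hσ, sameCycle_apply_right, ← hmem]; exact hi
          simp [ht, hi', hc2 i' hi']

/-- Permuting whole blocks by π moves their first and their second elements alike, so the sign is
that of π squared. -/
lemma altTrace_blockPerm_conj {m : ℕ} (σ : Perm (Option (Fin m))) (π : Perm (Fin m))
    (A : Option (Fin m) ⊕ Fin m → Matrix ι ι ℂ) :
    altTrace (blockPerm (optionCongr π * σ * (optionCongr π)⁻¹)) A = altTrace (blockPerm σ) A := by
  have h : blockPerm (optionCongr π * σ * (optionCongr π)⁻¹) =
      Perm.sumCongr (optionCongr π) π * blockPerm σ * (Perm.sumCongr (optionCongr π) π)⁻¹ := by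
    rw [eq_mul_inv_iff_mul_eq]
    ext1 x
    rw [mul_apply, mul_apply]
    rcases x with ((_ | i) | i)
    · have h2 : (optionCongr π)⁻¹ none = none := by
        rw [inv_eq_iff_eq]; simp
      have h3 : Perm.sumCongr (optionCongr π) π (Sum.inl none) = Sum.inl none := by simp
      rw [h3, blockPerm_none, blockPerm_none, mul_apply, mul_apply, h2]
      simp
    · simp
    · have h2 : ∀ i, (optionCongr π)⁻¹ (some (π i)) = some i := fun i => by
        rw [inv_eq_iff_eq]; simp
      simp [mul_apply, h2]
  rw [h, altTrace_conj, sign_sumCongr, optionCongr_sign, Int.units_mul_self, one_smul]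

/-- A transitive permutation. -/
def IsFullCycle (σ : Perm α) : Prop := ∀ x y, σ.SameCycle x y

lemma exists_conj_of_isFullCycle {σ ρ : Perm α} (hσ : IsFullCycle σ)
    (hρ : IsFullCycle ρ) : ∃ π : Perm α, σ = π * ρ * π⁻¹ := by
  have key : ∀ {σ : Perm α}, IsFullCycle σ → Nontrivial α →
      σ.cycleType = {Fintype.card α} := by
    intro σ hσ hn
    have hne : ∀ x, σ x ≠ x := by
      intro x hx
      obtain ⟨y, hy⟩ := exists_ne x
      exact hy ((hσ x y).eq_of_left hx).symm
    obtain ⟨x⟩ := hn.to_nonempty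
    have hcyc : σ.IsCycle := ⟨x, hne x, fun y _ => hσ x y⟩
    rw [hcyc.cycleType]
    congr 1
    rw [← Finset.card_univ]
    congr 1
    ext y; simp [hne y]
  -- On at most one point a full cycle is the identity, whose cycle type is empty, so the formula
  -- for the cycle type fails there.
  rcases subsingleton_or_nontrivial α with h | h
  · exact ⟨1, Subsingleton.elim _ _⟩
  · have : IsConj ρ σ := isConj_iff_cycleType_eq.2 (by rw [key hσ h, key hρ h])
    obtain ⟨π, hπ⟩ := isConj_iff.1 this
    exact ⟨π, hπ.symm⟩

/-- A conjugating permutation may be multiplied by a power of ρ without changing its effect. Since ρ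
is transitive, a suitable power makes it fix `none`. -/
lemma exists_optionCongr_conj_of_isFullCycle {m : ℕ} {σ ρ : Perm (Option (Fin m))}
    (hσ : IsFullCycle σ) (hρ : IsFullCycle ρ) :
    ∃ π : Perm (Fin m), σ = optionCongr π * ρ * (optionCongr π)⁻¹ := by
  obtain ⟨π, hπ⟩ := exists_conj_of_isFullCycle hσ hρ
  obtain ⟨k, hk⟩ := hρ none (π⁻¹ none)
  set π' := π * ρ ^ k with hπ'
  have h1 : π' none = none := by rw [hπ', mul_apply, hk, ← mul_apply, mul_inv_cancel, one_apply]
  have h2 : σ = π' * ρ * π'⁻¹ := by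
    rw [hπ, hπ', mul_inv_rev]
    rw [mul_assoc π (ρ ^ k) ρ, ((Commute.refl ρ).zpow_left k).eq]
    simp only [mul_assoc, mul_inv_cancel_left]
  refine ⟨removeNone π', ?_⟩
  have h3 : optionCongr (removeNone π') = π' := by
    ext1 x
    rcases x with _ | x
    · simp [h1]
    · rw [optionCongr_apply, Option.map_some, removeNone_some]
      by_contra! hne
      have h4 : π' (some x) = π' none := by
        rw [h1]; exact Option.eq_none_iff_forall_ne_some.2 hne
      exact Option.some_ne_none _ (π'.injective h4)
  rw [h3]; exact h2

lemma isFullCycle_blockPerm {m : ℕ} {σ : Perm (Option (Fin m))} (hσ : IsFullCycle σ) :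
    IsFullCycle (blockPerm σ) := by
  have h1 : ∀ x y, (blockPerm σ).SameCycle x (Sum.inl y) →
      (blockPerm σ).SameCycle x (Sum.inl (σ y)) := by
    rintro x (_ | j) h
    · rw [← blockPerm_none]; exact sameCycle_apply_right.2 h
    · rw [← blockPerm_inr, ← blockPerm_some σ j]
      exact sameCycle_apply_right.2 (sameCycle_apply_right.2 h)
  have h2 : ∀ y, (blockPerm σ).SameCycle (Sum.inl none) (Sum.inl y) := by
    intro y
    obtain ⟨k, -, -, rfl⟩ := (hσ none y).exists_pow_eq
    induction k with
    | zero => exact SameCycle.refl _ _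
    | succ k ih => rw [pow_succ', mul_apply]; exact h1 _ _ ih
  have h3 : ∀ x, (blockPerm σ).SameCycle (Sum.inl none) x := by
    rintro (y | j)
    · exact h2 y
    · rw [← blockPerm_some σ j]; exact sameCycle_apply_right.2 (h2 _)
  exact fun x y => (h3 x).symm.trans (h3 y)

lemma isFullCycle_finRotate (n : ℕ) : IsFullCycle (finRotate (n + 1)) := by
  rcases n with _ | n
  · intro x y
    have : Subsingleton (Fin (0 + 1)) := inferInstanceAs (Subsingleton (Fin 1))
    rw [Subsingleton.elim x y]
  · intro x y
    have h := isCycle_finRotate (n := n)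
    have hs : ∀ z, finRotate (n + 2) z ≠ z := fun z => by
      rw [← mem_support, support_finRotate]; exact Finset.mem_univ z
    exact h.sameCycle (hs x) (hs y)

lemma IsFullCycle.conj {β γ : Type*} {σ : Perm β} (hσ : IsFullCycle σ) (e : β ≃ γ) :
    IsFullCycle ((e.symm.trans σ).trans e) := by
  have hp : ∀ (k : ℤ), ((e.symm.trans σ).trans e) ^ k = (e.symm.trans (σ ^ k)).trans e := by
    intro k
    exact (map_zpow e.permCongrHom σ k).symm
  intro x y
  obtain ⟨k, hk⟩ := hσ (e.symm x) (e.symm y)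
  exact ⟨k, by rw [hp]; simp [hk]⟩

/-- The alternating trace of `2 m + 1` matrices of size at most `m` vanishes. -/
lemma altTrace_blockPerm_eq_zero_of_card_le {m : ℕ} (A : Option (Fin m) ⊕ Fin m → Matrix ι ι ℂ)
    (S : Finset ι) (hS : S.card ≤ m) (hA : ∀ a, ∀ i ∉ S, ∀ j, A a i j = 0)
    {ρ : Perm (Option (Fin m))} (hρ : IsFullCycle ρ) : altTrace (blockPerm ρ) A = 0 := by
  classical
  -- The pigeonhole lemma for each fixed τ: the m+1 first elements of the blocks carry at most m
  -- labels.
  have h1 : ∑ σ : Perm (Option (Fin m)), sign σ • altTrace (blockPerm σ) A = 0 := by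
    simp only [altTrace, Finset.smul_sum]
    rw [Finset.sum_comm]
    refine Finset.sum_eq_zero fun τ _ => ?_
    have := sum_sign_cycleTrace_eq_zero (swapOn Finset.univ) (A ∘ τ) S
      (by simpa using Nat.lt_succ_of_le hS) (fun a => hA (τ a))
    have h2 := congrArg (fun z => sign τ • z) this
    simp only [smul_zero, Finset.smul_sum] at h2
    rw [← h2]
    exact Finset.sum_congr rfl fun σ _ => smul_comm _ _ _
  have h2 : ∀ σ : Perm (Option (Fin m)), sign σ • altTrace (blockPerm σ) A =
      if IsFullCycle σ then sign ρ • altTrace (blockPerm ρ) A else 0 := by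
    intro σ
    split_ifs with h
    · obtain ⟨π, rfl⟩ := exists_optionCongr_conj_of_isFullCycle h hρ
      rw [altTrace_blockPerm_conj, Perm.sign_mul, Perm.sign_mul, sign_inv, mul_right_comm,
        Int.units_mul_self, one_mul]
    · have : ∃ j : Fin m, ¬ σ.SameCycle (some j) none := by
        by_contra! hcon
        have h3 : ∀ x, σ.SameCycle x none := by
          rintro (_ | j)
          · exact SameCycle.refl _ _
          · exact hcon j
        exact h fun x y => (h3 x).trans (h3 y).symm
      obtain ⟨j, hj⟩ := this
      rw [altTrace_blockPerm_eq_zero σ j hj, smul_zero]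
  -- What is left is the number of full cycles times one signed value, and ρ itself shows that this
  -- number is not zero.
  rw [Finset.sum_congr rfl fun σ _ => h2 σ, ← Finset.sum_filter, Finset.sum_const, smul_eq_zero] at h1
  rcases h1 with h1 | h1
  · rw [Finset.card_eq_zero, Finset.filter_eq_empty_iff] at h1
    exact absurd hρ (h1 (Finset.mem_univ ρ))
  · rw [Units.smul_def, smul_eq_zero] at h1
    exact h1.resolve_left (Units.ne_zero _)

/-! ### From cycle traces to traces of matrix products -/

lemma altTrace_comp {β : Type*} [Fintype β] [DecidableEq β] (s : Perm β)
    (A : α → Matrix ι ι ℂ) (e : β ≃ α) :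
    altTrace s (A ∘ e) = altTrace ((e.symm.trans s).trans e) A := by
  unfold altTrace
  refine Fintype.sum_equiv e.permCongr _ _ fun τ => ?_
  rw [sign_permCongr]
  congr 1
  rw [← cycleTrace_comp]
  congr 1
  ext x
  simp

/-- Sum over walks of q steps. Prescribing the endpoints by an indicator, and not by the type, lets
the induction split off the first vertex. -/
lemma prod_ofFn_apply [DecidableEq ι] {q : ℕ} (A : Fin q → Matrix ι ι ℂ) (i j : ι) :
    (List.ofFn A).prod i j = ∑ h : Fin (q + 1) → ι,
      if h 0 = i ∧ h (Fin.last q) = j then ∏ a : Fin q, A a (h a.castSucc) (h a.succ) else 0 := by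
  induction q generalizing i with
  | zero =>
    rw [List.ofFn_zero, List.prod_nil, Fintype.sum_equiv (Equiv.funUnique (Fin 1) ι) _
      (fun x => if x = i ∧ x = j then 1 else 0) (fun h => by simp)]
    rw [Matrix.one_apply]
    by_cases h : i = j
    · subst h; simp
    · rw [if_neg h]
      symm
      exact Finset.sum_eq_zero fun x _ => if_neg fun hx => h (hx.1.symm.trans hx.2)
  | succ q ih =>
    rw [List.ofFn_succ, List.prod_cons, Matrix.mul_apply,
      ← Fintype.sum_equiv (Fin.consEquiv fun _ => ι) (fun x : ι × (Fin (q + 1) → ι) => if x.1 = i ∧ x.2 (Fin.last q) = j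
        then A 0 x.1 (x.2 0) * ∏ a : Fin q, A a.succ (x.2 a.castSucc) (x.2 a.succ) else 0) _ ?_]
    · rw [Fintype.sum_prod_type]
      conv_rhs => rw [Finset.sum_eq_single i (fun b _ hb =>
        Finset.sum_eq_zero fun x _ => if_neg fun hx => hb hx.1) (by simp)]
      · simp only [ih, Finset.mul_sum]
        rw [Finset.sum_comm]
        refine Finset.sum_congr rfl fun h _ => ?_
        rw [Finset.sum_eq_single (h 0)]
        · simp
        · intro b _ hb; rw [if_neg (fun hx => hb hx.1.symm), mul_zero]
        · simp
    · rintro ⟨x, h⟩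
      rw [Fin.prod_univ_succ]
      simp [Fin.consEquiv, ← Fin.succ_last]

lemma trace_prod_ofFn [DecidableEq ι] {q : ℕ} (A : Fin (q + 1) → Matrix ι ι ℂ) :
    (List.ofFn A).prod.trace = cycleTrace (finRotate (q + 1)) A := by
  -- The last factor is split off because it is the edge that closes the walk, from `h (Fin.last q)`
  -- back to `h 0`, as `finRotate` does.
  rw [List.ofFn_succ', List.prod_concat, Matrix.trace]
  simp only [Matrix.diag, Matrix.mul_apply, prod_ofFn_apply, Finset.sum_mul]
  rw [cycleTrace, Finset.sum_congr rfl fun i _ => Finset.sum_comm, Finset.sum_comm]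
  refine Finset.sum_congr rfl fun h _ => ?_
  rw [Finset.sum_eq_single (h 0), Finset.sum_eq_single (h (Fin.last q))]
  · rw [if_pos ⟨rfl, rfl⟩, Fin.prod_univ_castSucc]
    congr 1
    · refine Finset.prod_congr rfl fun a _ => ?_
      congr 2
      simp
    · congr 2
      simp
  · intro b _ hb; rw [if_neg (fun hx => hb hx.2.symm), zero_mul]
  · simp
  · intro b _ hb
    exact Finset.sum_eq_zero fun x _ => by rw [if_neg (fun hx => hb hx.1.symm), zero_mul]
  · simp

/-- The Amitsur–Levitzki theorem, for the trace of an odd number of matrices: if `2 m + 1` matrices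
have at most `m` rows that are not zero, then the alternating sum of the traces of their products
vanishes. -/
theorem sum_sign_trace_prod_eq_zero [DecidableEq ι] {m : ℕ} (A : Fin (2 * m + 1) → Matrix ι ι ℂ)
    (S : Finset ι) (hS : S.card ≤ m) (hA : ∀ a, ∀ i ∉ S, ∀ j, A a i j = 0) :
    ∑ τ : Perm (Fin (2 * m + 1)), sign τ • (List.ofFn (A ∘ τ)).prod.trace = 0 := by
  simp only [trace_prod_ofFn]
  change altTrace (finRotate (2 * m + 1)) A = 0
  have hcard : Fintype.card (Option (Fin m) ⊕ Fin m) = Fintype.card (Fin (2 * m + 1)) := by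
    simp; ring
  -- `trace_prod_ofFn` concerns `finRotate`, the vanishing concerns `blockPerm`. Both are full
  -- cycles on 2m+1 points, hence conjugate, so their alternating traces agree up to sign.
  set e : Option (Fin m) ⊕ Fin m ≃ Fin (2 * m + 1) := Fintype.equivOfCardEq hcard
  have hcard' : Fintype.card (Fin (m + 1)) = Fintype.card (Option (Fin m)) := by simp
  have hρ := (isFullCycle_finRotate m).conj (Fintype.equivOfCardEq hcard')
  have h1 := altTrace_blockPerm_eq_zero_of_card_le (A ∘ e) S hS (fun a => hA (e a)) hρ
  rw [altTrace_comp] at h1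
  obtain ⟨π, hπ⟩ := exists_conj_of_isFullCycle (isFullCycle_finRotate (2 * m))
    ((isFullCycle_blockPerm hρ).conj e)
  rw [hπ, altTrace_conj, h1, smul_zero]

end AlternatingTrace

/-! ### Oriented partitions and integrals of forms with vanishing pullback -/

section Integration

variable {V : Type*} [NormedAddCommGroup V] [NormedSpace ℝ V]

/-- By the Lindelöf property countably many charts cover `M`; each piece is the part of a chart not
met by the earlier ones. All charts of the atlas are positive by compatibility. -/
lemma nonempty_orientedPartition [SecondCountableTopology V] {M : Set V} {d : ℕ}
    (hM : M.Nonempty) (o : OrientedAtlas M d) : Nonempty (OrientedPartition o) := by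
  classical
  choose O hO hfO using fun f : o.charts => f.1.image_open f.1.source subset_rfl f.1.isOpen_source
  obtain ⟨T, hTc, hT⟩ := TopologicalSpace.isOpen_iUnion_countable O hO
  have hMO : ∀ p ∈ M, ∃ f ∈ T, p ∈ O f := by
    intro p hp
    obtain ⟨f, hf, hpf⟩ := o.covers p hp
    have h1 : p ∈ ⋃ i, O i := Set.mem_iUnion.2 ⟨⟨f, hf⟩, by
      have := hfO ⟨f, hf⟩
      rw [this] at hpf
      exact hpf.2⟩
    rw [← hT] at h1
    simpa using h1
  -- A partition assigns a chart to every natural number, so at least one chart must exist.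
  obtain ⟨p₀, hp₀⟩ := hM
  obtain ⟨f₀, hf₀, -⟩ := hMO p₀ hp₀
  obtain ⟨g, hg⟩ := hTc.exists_eq_range ⟨f₀, hf₀⟩
  have hcov : ∀ p ∈ M, ∃ i, p ∈ O (g i) := by
    intro p hp
    obtain ⟨f, hf, hpf⟩ := hMO p hp
    rw [hg] at hf
    obtain ⟨i, rfl⟩ := hf
    exact ⟨i, hpf⟩
  have hmemO : ∀ i, ∀ x ∈ (g i).1.source, (g i).1.toFun x ∈ M ∩ O (g i) := fun i x hx => by
    rw [← hfO]; exact Set.mem_image_of_mem _ hx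
  refine ⟨{
    chart := fun i => (g i).1
    piece := fun i => (g i).1.source \ ⋃ j ∈ Finset.range i,
      ((g i).1.source ∩ (g i).1.toFun ⁻¹' O (g j))
    isPositive := fun i f hf => o.compatible _ (g i).2 _ hf
    measurableSet_piece := fun i => ?_
    piece_subset := fun i => Set.sdiff_subset
    disjoint := ?_
    covers := ?_ }⟩
  · refine (g i).1.isOpen_source.measurableSet.diff (Finset.measurableSet_biUnion _ fun j _ => ?_)
    exact ((g i).1.contDiffOn.continuousOn.isOpen_inter_preimage (g i).1.isOpen_source
      (hO _)).measurableSet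
  · have key : ∀ i j, i < j → Disjoint
        ((g i).1.toFun '' ((g i).1.source \ ⋃ l ∈ Finset.range i,
          ((g i).1.source ∩ (g i).1.toFun ⁻¹' O (g l))))
        ((g j).1.toFun '' ((g j).1.source \ ⋃ l ∈ Finset.range j,
          ((g j).1.source ∩ (g j).1.toFun ⁻¹' O (g l)))) := by
      intro i j hij
      rw [Set.disjoint_left]
      rintro _ ⟨x, hx, rfl⟩ ⟨y, hy, hxy⟩
      refine hy.2 (Set.mem_biUnion (Finset.mem_coe.2 (Finset.mem_range.2 hij)) ⟨hy.1, ?_⟩)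
      rw [Set.mem_preimage, hxy]
      exact (hmemO i x hx.1).2
    intro i j hij
    rcases lt_or_gt_of_ne hij with h | h
    · exact key i j h
    · exact (key j i h).symm
  · ext p
    simp only [Set.mem_iUnion]
    constructor
    · rintro ⟨i, x, hx, rfl⟩
      exact (hmemO i x hx.1).1
    · intro hp
      have hex := hcov p hp
      have h1 : p ∈ M ∩ O (g (Nat.find hex)) := ⟨hp, Nat.find_spec hex⟩
      rw [← hfO] at h1
      obtain ⟨x, hx, hxp⟩ := h1
      refine ⟨Nat.find hex, x, ⟨hx, ?_⟩, hxp⟩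
      simp only [Set.mem_iUnion, not_exists]
      rintro j hj ⟨-, h2⟩
      rw [Set.mem_preimage, hxp] at h2
      exact Nat.find_min hex (Finset.mem_range.1 hj) h2

lemma hasFormIntegral_zero [SecondCountableTopology V] {M : Set V} {d p : ℕ} (hM : M.Nonempty)
    (o : OrientedAtlas M d) (η : V → V [⋀^Fin p]→ₗ[ℝ] ℂ)
    (h : ∀ f : Param M d, ∀ x ∈ f.source, pullbackCoeff η f.toFun x = 0) :
    HasFormIntegral o η 0 := by
  refine ⟨nonempty_orientedPartition hM o, fun P => ?_⟩
  have h0 : ∀ i, Set.EqOn (pullbackCoeff η (P.chart i).toFun) (fun _ => 0) (P.piece i) :=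
    fun i x hx => h _ x (P.piece_subset i hx)
  have h1 : ∀ i, ∫ x in P.piece i, ‖pullbackCoeff η (P.chart i).toFun x‖ = 0 := fun i => by
    rw [setIntegral_congr_fun (g := fun _ => (0 : ℝ)) (P.measurableSet_piece i)
      (fun x hx => by simp [h0 i hx])]
    simp
  have h2 : ∀ i, ∫ x in P.piece i, pullbackCoeff η (P.chart i).toFun x = 0 := fun i => by
    rw [setIntegral_congr_fun (P.measurableSet_piece i) (h0 i)]
    simp
  refine ⟨fun i => ?_, ?_, ?_⟩
  · exact (integrableOn_congr_fun (h0 i) (P.measurableSet_piece i)).2 integrableOn_zero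
  · simp only [h1]; exact summable_zero
  · simp only [h2]; exact hasSum_zero

/-- A global parametrization orients its image. -/
def Param.toOrientedAtlas {M : Set V} {d : ℕ} (f : Param M d) (hf : M ⊆ f.toFun '' f.source) :
    OrientedAtlas M d where
  charts := {f}
  covers p hp := ⟨f, rfl, hf hp⟩
  compatible := by
    rintro g rfl h rfl x hx y hy hxy
    obtain rfl := h.injOn hx hy hxy
    exact ⟨LinearMap.id, by simp, fun v => rfl⟩

/-- An injective immersion of `ℝ ^ d` with a differentiable left inverse which is defined on a
neighbourhood of the image. -/
def Param.ofLeftInverse {d : ℕ} (f : (Fin d → ℝ) → V) (hf : ContDiff ℝ ∞ f)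
    (Ω : Set V) (hΩ : IsOpen Ω) (hfΩ : ∀ x, f x ∈ Ω) (ρ : V → (Fin d → ℝ))
    (hρ : DifferentiableOn ℝ ρ Ω) (hρf : ∀ x, ρ (f x) = x) : Param (Set.range f) d where
  toFun := f
  source := Set.univ
  isOpen_source := isOpen_univ
  contDiffOn := hf.contDiffOn
  injOn := (Function.LeftInverse.injective hρf).injOn
  injective_fderiv x _ := by
    have h1 : HasFDerivAt ρ (fderiv ℝ ρ (f x)) (f x) :=
      ((hρ _ (hfΩ x)).differentiableAt (hΩ.mem_nhds (hfΩ x))).hasFDerivAt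
    have h2 : HasFDerivAt f (fderiv ℝ f x) x :=
      (hf.differentiable (by simp) x).hasFDerivAt
    have h3 := h1.comp x h2
    have h4 : ρ ∘ f = id := funext hρf
    rw [h4] at h3
    have h5 := h3.unique (hasFDerivAt_id x)
    refine Function.LeftInverse.injective (g := fderiv ℝ ρ (f x)) fun v => ?_
    exact DFunLike.congr_fun h5 v
  image_open S _ hS := by
    refine ⟨Ω ∩ ρ ⁻¹' S, hρ.continuousOn.isOpen_inter_preimage hΩ hS, ?_⟩
    ext p
    constructor
    · rintro ⟨x, hx, rfl⟩
      exact ⟨⟨x, rfl⟩, hfΩ x, by rwa [Set.mem_preimage, hρf]⟩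
    · rintro ⟨⟨x, rfl⟩, -, hx⟩
      rw [Set.mem_preimage, hρf] at hx
      exact ⟨x, hx, rfl⟩

end Integration

/-! ### Vanishing of the forms `Tc_k` -/

section Vanishing

variable {E : Type*} [NormedAddCommGroup E] [InnerProductSpace ℂ E] [CompleteSpace E]
  [FiniteDimensional ℂ E] {ι : Type*} [Fintype ι] [DecidableEq ι]

lemma traceR_list_prod (e : OrthonormalBasis ι ℂ E) (l : List (E →L[ℂ] E)) :
    traceR E l.prod =
      (l.map fun X => (Matrix.of fun i j => ⟪e i, X (e j)⟫ : Matrix ι ι ℂ)).prod.trace := by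
  have h1 : ∀ X : E →L[ℂ] E, (Matrix.of fun i j => ⟪e i, X (e j)⟫ : Matrix ι ι ℂ) =
      LinearMap.toMatrix e.toBasis e.toBasis (X : E →ₗ[ℂ] E) := by
    intro X
    ext i j
    simp [LinearMap.toMatrix_apply, OrthonormalBasis.repr_apply_apply]
  have h2 : (l.map fun X => (Matrix.of fun i j => ⟪e i, X (e j)⟫ : Matrix ι ι ℂ)).prod =
      LinearMap.toMatrix e.toBasis e.toBasis (l.prod : E →ₗ[ℂ] E) := by
    induction l with
    | nil => exact (LinearMap.toMatrix_one e.toBasis).symm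
    | cons X l ih =>
      rw [List.map_cons, List.prod_cons, List.prod_cons, ih, h1, ← LinearMap.toMatrix_mul]
      rfl
  rw [h2, ← LinearMap.trace_eq_matrix_trace]
  rfl

/-- Since `g` fixes e_i for i ∉ S, row i of g^*v equals row i of v, which is zero. The trace
identity then applies to the matrices of g^*v. -/
lemma maurerCartanTrace_eq_zero (e : OrthonormalBasis ι ℂ E) (S : Finset ι) {m p : ℕ}
    (hp : p = 2 * m + 1) (hS : S.card ≤ m) (g : E →L[ℂ] E) (hg : ∀ i ∉ S, g (e i) = e i)
    (v : Fin p → E →L[ℂ] E) (hv : ∀ a, ∀ i ∉ S, ∀ j, ⟪e i, v a (e j)⟫ = 0) :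
    maurerCartanTrace E p g v = 0 := by
  subst hp
  rw [maurerCartanTrace, MultilinearMap.alternatization_apply]
  rw [← sum_sign_trace_prod_eq_zero
    (fun a => (Matrix.of fun i j => ⟪e i, (star g * v a) (e j)⟫ : Matrix ι ι ℂ)) S hS ?_]
  · refine Finset.sum_congr rfl fun τ _ => ?_
    congr 1
    have : (List.ofFn ((fun a => (Matrix.of fun i j => ⟪e i, (star g * v a) (e j)⟫ :
        Matrix ι ι ℂ)) ∘ τ)) = (List.ofFn fun a => star g * v (τ a)).map
          fun X => (Matrix.of fun i j => ⟪e i, X (e j)⟫ : Matrix ι ι ℂ) := by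
      rw [List.map_ofFn]; rfl
    rw [this, ← traceR_list_prod]
    simp [MultilinearMap.mkPiAlgebraFin_apply]
  · intro a i hi j
    rw [Matrix.of_apply, mul_apply_eq_comp, ContinuousLinearMap.star_eq_adjoint,
      ContinuousLinearMap.adjoint_inner_right, hg i hi, hv a i hi j]

/-- A unitary U with U e_i = e_i also has U^* e_i = e_i, so row i of U is constant along `M` and
tangent vectors have zero row i. -/
lemma pullbackCoeff_Tc_eq_zero (e : OrthonormalBasis ι ℂ E) (S : Finset ι) {M : Set (E →L[ℂ] E)}
    (hM : ∀ U ∈ M, U ∈ unitary (E →L[ℂ] E) ∧ ∀ i ∉ S, U (e i) = e i) {d k : ℕ}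
    (hS : d = 2 * k - 1 → S.card < k) (f : Param M d) {x : Fin d → ℝ} (hx : x ∈ f.source) :
    pullbackCoeff (Tc E k) f.toFun x = 0 := by
  unfold pullbackCoeff
  split_ifs with h
  swap
  · rfl
  have hS' := hS h.symm
  obtain ⟨m, rfl⟩ : ∃ m, k = m + 1 := ⟨k - 1, by omega⟩
  have hfM : ∀ y ∈ f.source, f.toFun y ∈ M := fun y hy => by
    obtain ⟨O, -, hO⟩ := f.image_open f.source subset_rfl f.isOpen_source
    have := hO ▸ Set.mem_image_of_mem f.toFun hy
    exact this.1
  rw [Tc, AlternatingMap.smul_apply, maurerCartanTrace_eq_zero e S (m := m) (by omega) (by omega) _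
    (hM _ (hfM x hx)).2, smul_zero]
  intro a i hi j
  have hd : HasFDerivAt f.toFun (fderiv ℝ f.toFun x) x :=
    ((f.contDiffOn.differentiableOn (by simp) x hx).differentiableAt
      (f.isOpen_source.mem_nhds hx)).hasFDerivAt
  set ℓ : (E →L[ℂ] E) →L[ℝ] ℂ :=
    ((innerSL ℂ (e i)).comp (ContinuousLinearMap.apply ℂ E (e j))).restrictScalars ℝ with hℓ
  have hℓ' : ∀ X, ℓ X = ⟪e i, X (e j)⟫ := fun X => by simp [hℓ]
  have h1 : HasFDerivAt (fun y => ℓ (f.toFun y)) (ℓ.comp (fderiv ℝ f.toFun x)) x :=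
    ℓ.hasFDerivAt.comp x hd
  have h2 : (fun y => ℓ (f.toFun y)) =ᶠ[𝓝 x] fun _ => ⟪e i, e j⟫ := by
    filter_upwards [f.isOpen_source.mem_nhds hx] with y hy
    obtain ⟨hu, hfix⟩ := hM _ (hfM y hy)
    rw [hℓ']
    have h3 : star (f.toFun y) (e i) = e i := by
      conv_lhs => rw [← hfix i hi]
      rw [← mul_apply_eq_comp, Unitary.star_mul_self_of_mem hu]
      rfl
    rw [← ContinuousLinearMap.adjoint_inner_left, ← ContinuousLinearMap.star_eq_adjoint, h3]
  have h4 := h1.unique ((hasFDerivAt_const ⟪e i, e j⟫ x).congr_of_eventuallyEq h2)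
  rw [← hℓ']
  exact DFunLike.congr_fun h4 _

end Vanishing

/-! ### The Cayley parametrization of a cell of the unitary group -/

section Cell

variable {E : Type*} [NormedAddCommGroup E] [InnerProductSpace ℂ E] [CompleteSpace E]
  [FiniteDimensional ℂ E]

lemma isUnit_of_injective {X : E →L[ℂ] E} (h : ∀ v, X v = 0 → v = 0) : IsUnit X := by
  rw [ContinuousLinearMap.isUnit_iff_bijective]
  have h1 : Function.Injective (X : E →ₗ[ℂ] E) := (injective_iff_map_eq_zero _).2 h
  exact ⟨h1, LinearMap.injective_iff_surjective.1 h1⟩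

lemma mul_eq_one_swap {X Y : E →L[ℂ] E} (h : X * Y = 1) : Y * X = 1 := by
  have h1 : IsUnit Y := isUnit_of_injective fun v hv => by
    have := DFunLike.congr_fun h v
    rw [mul_apply_eq_comp, hv, map_zero] at this
    exact this.symm
  have h2 : X = Ring.inverse Y := by
    rw [← mul_one X, ← Ring.mul_inverse_cancel _ h1, ← mul_assoc, h, one_mul]
  rw [h2, Ring.mul_inverse_cancel _ h1]

/-- The coordinates of a cell: `B` spans the range of `1 - U`, and `H` is the skew-Hermitian Cayley
coordinate of the restriction of `U` to this range. -/
structure IsCellPair (P B H : E →L[ℂ] E) : Prop where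
  mul_left : P * B = P
  mul_right : B * P = B
  mul_skew : P * H = H
  star_skew : star H = -H

/-- The operator inverse to the compression of `1 - U`. -/
def cellK (P B H : E →L[ℂ] E) : E →L[ℂ] E := (2⁻¹ : ℂ) • (star B * B) + H + (1 - P)

/-- The point with coordinates `B`, `H`. -/
def cellPoint (P B H : E →L[ℂ] E) : E →L[ℂ] E :=
  1 - B * Ring.inverse (cellK P B H) * star B

variable {P B H : E →L[ℂ] E}

namespace IsCellPair

lemma skew_mul (h : IsCellPair P B H) (hP : star P = P) : H * P = H := by
  have h1 := congrArg star h.mul_skew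
  rw [star_mul, h.star_skew, hP, neg_mul, neg_inj] at h1
  exact h1

lemma star_mul_right (h : IsCellPair P B H) (hP : star P = P) : star B * P = P := by
  have h1 := congrArg star h.mul_left
  rwa [star_mul, hP] at h1

lemma mul_star_left (h : IsCellPair P B H) (hP : star P = P) : P * star B = star B := by
  have h1 := congrArg star h.mul_right
  rwa [star_mul, hP] at h1

lemma cellK_add_star (h : IsCellPair P B H) (hP : star P = P) :
    cellK P B H + star (cellK P B H) = star B * B + (2 : ℂ) • (1 - P) := by
  simp only [cellK, star_add, star_smul, star_mul, star_star, star_sub, star_one, hP, h.star_skew]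
  have : star (2⁻¹ : ℂ) = 2⁻¹ := by simp
  rw [this]
  module

/-- The Hermitian part of K is positive definite: K + K^* = B^*B + 2(1 - P), and Bv = 0 gives Pv =
PBv = 0. -/
lemma isUnit_cellK (h : IsCellPair P B H) (hP : star P = P) (hPP : P * P = P) :
    IsUnit (cellK P B H) := by
  refine isUnit_of_injective fun v hv => ?_
  have h1 : ⟪v, (cellK P B H + star (cellK P B H)) v⟫ = 0 := by
    rw [add_apply, inner_add_right, ContinuousLinearMap.star_eq_adjoint,
      ContinuousLinearMap.adjoint_inner_right, hv, inner_zero_left, inner_zero_right, add_zero]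
  have h2 : (1 - P) = star (1 - P) * (1 - P) := by
    rw [star_sub, star_one, hP, mul_sub, sub_mul, sub_mul, hPP]
    simp
  rw [h.cellK_add_star hP, h2, add_apply, inner_add_right,
    smul_apply, mul_apply_eq_comp, mul_apply_eq_comp,
    ContinuousLinearMap.star_eq_adjoint, ContinuousLinearMap.star_eq_adjoint, inner_smul_right,
    ContinuousLinearMap.adjoint_inner_right, ContinuousLinearMap.adjoint_inner_right,
    inner_self_eq_norm_sq_to_K, inner_self_eq_norm_sq_to_K] at h1
  have h3 : ‖B v‖ ^ 2 + 2 * ‖(1 - P) v‖ ^ 2 = 0 := by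
    apply Complex.ofReal_injective
    push_cast
    exact h1
  have h4 : B v = 0 := by
    rw [← norm_eq_zero, ← sq_eq_zero_iff]; nlinarith [sq_nonneg ‖B v‖, sq_nonneg ‖(1 - P) v‖]
  have h5 : (1 - P) v = 0 := by
    rw [← norm_eq_zero, ← sq_eq_zero_iff]; nlinarith [sq_nonneg ‖B v‖, sq_nonneg ‖(1 - P) v‖]
  have h6 : P v = 0 := by rw [← h.mul_left, mul_apply_eq_comp, h4, map_zero]
  rw [sub_apply, h6, sub_zero] at h5
  exact h5

lemma cellK_mul_compl (h : IsCellPair P B H) (hP : star P = P) (hPP : P * P = P) :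
    cellK P B H * (1 - P) = 1 - P := by
  simp only [cellK, add_mul, smul_mul_assoc, mul_sub, mul_one, mul_assoc, h.mul_right,
    h.skew_mul hP, hPP, sub_mul, one_mul]
  simp

lemma compl_mul_cellK (h : IsCellPair P B H) (hP : star P = P) (hPP : P * P = P) :
    (1 - P) * cellK P B H = 1 - P := by
  simp only [cellK, mul_add, mul_smul_comm, mul_sub, mul_one, ← mul_assoc, h.mul_star_left hP,
    h.mul_skew, hPP, sub_mul, one_mul]
  simp

lemma inverse_mul_compl (h : IsCellPair P B H) (hP : star P = P) (hPP : P * P = P) :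
    Ring.inverse (cellK P B H) * (1 - P) = 1 - P := by
  conv_lhs => rw [← h.cellK_mul_compl hP hPP]
  rw [Ring.inverse_mul_cancel_left _ _ (h.isUnit_cellK hP hPP)]

lemma compl_mul_inverse (h : IsCellPair P B H) (hP : star P = P) (hPP : P * P = P) :
    (1 - P) * Ring.inverse (cellK P B H) = 1 - P := by
  conv_lhs => rw [← h.compl_mul_cellK hP hPP]
  rw [Ring.mul_inverse_cancel_right _ _ (h.isUnit_cellK hP hPP)]

lemma inverse_comm (h : IsCellPair P B H) (hP : star P = P) (hPP : P * P = P) :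
    Ring.inverse (cellK P B H) * P = P * Ring.inverse (cellK P B H) := by
  have h1 := (h.inverse_mul_compl hP hPP).trans (h.compl_mul_inverse hP hPP).symm
  rw [mul_sub, sub_mul, mul_one, one_mul] at h1
  exact sub_right_injective h1

/-- The compression of 1 - U to the range of P inverts K. Thus K, then B by `mul_cellK`, and finally
H are recovered from U; this is the source of `cellInv`. -/
lemma compress (h : IsCellPair P B H) (hP : star P = P) (hPP : P * P = P) :
    P * (1 - cellPoint P B H) * P + (1 - P) = Ring.inverse (cellK P B H) := by
  rw [cellPoint, sub_sub_cancel]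
  have : P * (B * Ring.inverse (cellK P B H) * star B) * P =
      (P * B) * Ring.inverse (cellK P B H) * (star B * P) := by simp only [mul_assoc]
  rw [this, h.mul_left, h.star_mul_right hP, mul_assoc, h.inverse_comm hP hPP, ← mul_assoc, hPP]
  conv_lhs => enter [2]; rw [← h.compl_mul_inverse hP hPP]
  rw [← add_mul]; simp

lemma inverse_compress (h : IsCellPair P B H) (hP : star P = P) (hPP : P * P = P) :
    Ring.inverse (P * (1 - cellPoint P B H) * P + (1 - P)) = cellK P B H := by
  rw [h.compress hP hPP, Ring.inverse_inverse (h.isUnit_cellK hP hPP)]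

lemma isUnit_compress (h : IsCellPair P B H) (hP : star P = P) (hPP : P * P = P) :
    IsUnit (P * (1 - cellPoint P B H) * P + (1 - P)) := by
  rw [h.compress hP hPP]
  exact (h.isUnit_cellK hP hPP).ringInverse

lemma mul_cellK (h : IsCellPair P B H) (hP : star P = P) (hPP : P * P = P) :
    (1 - cellPoint P B H) * P * cellK P B H = B := by
  rw [cellPoint, sub_sub_cancel]
  have : B * Ring.inverse (cellK P B H) * star B * P * cellK P B H =
      B * (Ring.inverse (cellK P B H) * (star B * P)) * cellK P B H := by simp only [mul_assoc]
  rw [this, h.star_mul_right hP, h.inverse_comm hP hPP, ← mul_assoc, h.mul_right,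
    Ring.inverse_mul_cancel_right _ _ (h.isUnit_cellK hP hPP)]

/-- With Q = 1 - U, unitarity amounts to Q + Q^* = Q Q^*. It follows from B^*B = K + K^* - 2(1 - P)
placed between B K⁻¹ and its adjoint, the last term being killed by B(1 - P) = 0. -/
lemma cellPoint_mem_unitary (h : IsCellPair P B H) (hP : star P = P) (hPP : P * P = P) :
    cellPoint P B H ∈ unitary (E →L[ℂ] E) := by
  set K := cellK P B H with hK
  set L := Ring.inverse K with hL
  have hu := h.isUnit_cellK hP hPP
  have hKL : K * L = 1 := Ring.mul_inverse_cancel _ hu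
  have hLK : L * K = 1 := Ring.inverse_mul_cancel _ hu
  have hKLs : star K * star L = 1 := by rw [← star_mul, hLK, star_one]
  have hBB : star B * B = K + star K - (2 : ℂ) • (1 - P) := by
    rw [hK, h.cellK_add_star hP]; simp
  have hL0 : L * (1 - P) = 1 - P := h.inverse_mul_compl hP hPP
  have hB0 : B * (1 - P) = 0 := by rw [mul_sub, mul_one, h.mul_right, sub_self]
  have key : cellPoint P B H * star (cellPoint P B H) = 1 := by
    have h1 : cellPoint P B H = 1 - B * L * star B := rfl
    have h2 : B * L * (star B * B) * star L * star B =
        B * L * star B + B * star L * star B := by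
      rw [hBB, mul_sub, mul_add, mul_smul_comm, mul_assoc B L (1 - P), hL0, hB0, smul_zero,
        sub_zero, mul_assoc B L K, hLK, mul_one, add_mul, mul_assoc _ (star K), hKLs, mul_one,
        add_mul, add_comm]
    rw [h1, star_sub, star_one, star_mul, star_mul, star_star]
    have h3 : B * L * star B * (B * (star L * star B)) =
        B * L * (star B * B) * star L * star B := by simp only [mul_assoc]
    rw [mul_sub, mul_one, sub_mul, one_mul, h3, h2]
    simp only [mul_assoc]
    abel
  exact Unitary.mem_iff.2 ⟨mul_eq_one_swap key, key⟩

end IsCellPair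

/-- A unitary operator `1 - Q` lies in the cell if `Q` and its compression have the shape which is
described by `B`. -/
lemma exists_cellPoint_eq {Q : E →L[ℂ] E} (hP : star P = P) (hPP : P * P = P)
    (hU : 1 - Q ∈ unitary (E →L[ℂ] E)) (hB1 : P * B = P) (hB2 : B * P = B)
    (hQ : Q = B * (P * Q * P) * star B) (hu : IsUnit (P * Q * P + (1 - P))) :
    ∃ H, IsCellPair P B H ∧ cellPoint P B H = 1 - Q := by
  set L := P * Q * P + (1 - P) with hL
  set K := Ring.inverse L with hK
  have hLK : L * K = 1 := Ring.mul_inverse_cancel _ hu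
  have hKL : K * L = 1 := Ring.inverse_mul_cancel _ hu
  have hLP : L * P = P * Q * P := by rw [hL, add_mul, mul_assoc, hPP, sub_mul, one_mul, hPP]; simp
  have hPL : P * L = P * Q * P := by
    rw [hL, mul_add, mul_assoc P Q P, ← mul_assoc P P, hPP, mul_sub, mul_one, hPP]; simp
  have hKP : K * P = P * K := by
    calc K * P = K * (P * L) * K := by rw [mul_assoc, mul_assoc, hLK, mul_one]
      _ = P * K := by rw [hPL, ← hLP, ← mul_assoc K, hKL, one_mul]
  have hL1 : L * (1 - P) = 1 - P := by rw [mul_sub, mul_one, hLP, hL]; abel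
  have hK1 : K * (1 - P) = 1 - P := by
    conv_lhs => rw [← hL1]
    rw [← mul_assoc, hKL, one_mul]
  have hK1' : (1 - P) * K = 1 - P := by
    rw [sub_mul, one_mul, ← hKP, ← hK1, mul_sub, mul_one]
  have hBs : star B * P = P := by rw [← hP, ← star_mul, hP, hB1, hP]
  have hBs' : P * star B = star B := by
    conv_lhs => rw [← hP]
    rw [← star_mul, hB2]
  have hQL : Q = B * L * star B := by
    have : B * (1 - P) = 0 := by rw [mul_sub, mul_one, hB2, sub_self]
    rw [hL, mul_add, this, add_zero]
    exact hQ
  have hQQ : Q + star Q = Q * star Q := by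
    have h1 := Unitary.mul_star_self_of_mem hU
    rw [star_sub, star_one, mul_sub, mul_one, sub_mul, one_mul] at h1
    have h2 : (1 : E →L[ℂ] E) - Q - (star Q - Q * star Q) = 1 - (Q + star Q - Q * star Q) := by
      abel
    rw [h2, sub_eq_self, sub_eq_zero] at h1
    exact h1
  -- The relation Q + Q^* = Q Q^* compressed to the range of P, with Q = B L B^*. The summand 2(1 -
  -- P) accounts for the identity block of L.
  have hLL : L + star L = L * (star B * B + (2 : ℂ) • (1 - P)) * star L := by
    have h1 : star L = P * star Q * P + (1 - P) := by
      rw [hL, star_add, star_mul, star_mul, star_sub, star_one, hP, mul_assoc]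
    have h2 : L * (star B * B) * star L = P * (Q * star Q) * P := by
      have h3 : Q * star Q = B * (L * (star B * B) * star L) * star B := by
        conv_lhs => rw [hQL]
        simp only [star_mul, star_star, mul_assoc]
      rw [h3]
      have h4 : P * (B * (L * (star B * B) * star L) * star B) * P =
          (P * B) * (L * (star B * B) * star L) * (star B * P) := by simp only [mul_assoc]
      have h5 : P * L = L * P := by rw [hPL, hLP]
      have h6 : star L * P = P * star L := by
        have := congrArg star h5
        rwa [star_mul, star_mul, hP] at this
      rw [h4, hB1, hBs]
      have h7 : P * (L * (star B * B) * star L) * P =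
        (P * L) * (star B * B) * (star L * P) := by simp only [mul_assoc]
      have h8 : (L * P) * (star B * B) * (P * star L) =
        L * ((P * star B) * (B * P)) * star L := by simp only [mul_assoc]
      rw [h7, h5, h6, h8, hBs', hB2]
    have h9 : (1 - P) * star L = 1 - P := by
      have := congrArg star hL1
      rwa [star_mul, star_sub, star_one, hP] at this
    rw [mul_add, add_mul, h2, ← hQQ, mul_smul_comm, hL1, smul_mul_assoc, h9, h1, mul_add, add_mul]
    rw [hL]
    module
  -- Multiplying by K and K^* turns the quadratic relation for L into a linear one for K = L⁻¹; it
  -- prescribes the Hermitian part of K, so the remainder H is skew.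
  have hKK : K + star K = star B * B + (2 : ℂ) • (1 - P) := by
    have h1 : star L * star K = 1 := by rw [← star_mul, hKL, star_one]
    have h2 := congrArg (fun X => K * X * star K) hLL
    have h3 : K * (L + star L) * star K = (K * L) * star K + K * (star L * star K) := by
      simp only [mul_add, add_mul, mul_assoc]
    have h4 : K * (L * (star B * B + (2 : ℂ) • (1 - P)) * star L) * star K =
      (K * L) * (star B * B + (2 : ℂ) • (1 - P)) * (star L * star K) := by simp only [mul_assoc]
    rw [h3, h4, hKL, h1, one_mul, one_mul, mul_one, mul_one] at h2
    rw [← h2, add_comm]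
  set H := K - (1 - P) - (2⁻¹ : ℂ) • (star B * B) with hH
  have hcell : cellK P B H = K := by rw [cellK, hH]; abel
  refine ⟨H, ⟨hB1, hB2, ?_, ?_⟩, ?_⟩
  · have h1 : (1 - P) * H = 0 := by
      rw [hH, mul_sub, mul_sub, hK1', mul_smul_comm, ← mul_assoc, sub_mul 1 P (star B), hBs']
      simp [mul_sub, sub_mul, hPP]
    rw [sub_mul, one_mul, sub_eq_zero] at h1
    exact h1.symm
  · have h1 : star K = star B * B + (2 : ℂ) • (1 - P) - K := by rw [← hKK]; abel
    have h2 : star (2⁻¹ : ℂ) = 2⁻¹ := by simp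
    rw [hH, star_sub, star_sub, star_sub, star_one, star_smul, star_mul, star_star, h1, hP, h2]
    module
  · rw [cellPoint, hcell, hK, Ring.inverse_inverse hu, ← hQL]

end Cell

/-! ### Coordinates with respect to an orthonormal basis -/

section Coordinates

variable {E : Type*} [NormedAddCommGroup E] [InnerProductSpace ℂ E]
  {n : ℕ} (e : OrthonormalBasis (Fin n) ℂ E)

/-- The matrix entries of an operator. -/
def entry (i j : Fin n) : (E →L[ℂ] E) →L[ℂ] ℂ :=
  (innerSL ℂ (e i)).comp (ContinuousLinearMap.apply ℂ E (e j))

lemma entry_apply (i j : Fin n) (X : E →L[ℂ] E) : entry e i j X = ⟪e i, X (e j)⟫ := by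
  simp [entry]

/-- The operator with a given matrix. -/
def ofMat (m : Fin n → Fin n → ℂ) : E →L[ℂ] E :=
  ∑ i, ∑ j, m i j • InnerProductSpace.rankOne ℂ (e i) (e j)

lemma entry_ofMat (m : Fin n → Fin n → ℂ) (i j : Fin n) : entry e i j (ofMat e m) = m i j := by
  rw [entry_apply, ofMat]
  simp [orthonormal_iff_ite.1 e.orthonormal]

variable {e} in
lemma ext_entry {X Y : E →L[ℂ] E} (h : ∀ i j, entry e i j X = entry e i j Y) : X = Y := by
  have : (X : E →ₗ[ℂ] E) = Y := by
    refine e.toBasis.ext fun j => ?_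
    refine e.toBasis.ext_elem fun i => ?_
    have := h i j
    rw [entry_apply, entry_apply] at this
    simpa [OrthonormalBasis.repr_apply_apply] using this
  exact ContinuousLinearMap.coe_injective this

lemma ofMat_entry (X : E →L[ℂ] E) : ofMat e (fun i j => entry e i j X) = X :=
  ext_entry fun i j => entry_ofMat e _ i j

lemma entry_mul (X Y : E →L[ℂ] E) (i j : Fin n) :
    entry e i j (X * Y) = ∑ l, entry e i l X * entry e l j Y := by
  simp only [entry_apply, mul_apply_eq_comp]
  conv_lhs => rw [← e.sum_repr' (Y (e j))]
  rw [map_sum, inner_sum]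
  refine Finset.sum_congr rfl fun l _ => ?_
  rw [map_smul, inner_smul_right, mul_comm]

lemma entry_star [CompleteSpace E] (X : E →L[ℂ] E) (i j : Fin n) :
    entry e i j (star X) = star (entry e j i X) := by
  rw [entry_apply, entry_apply, ContinuousLinearMap.star_eq_adjoint,
    ContinuousLinearMap.adjoint_inner_right]
  exact (inner_conj_symm _ _).symm

lemma entry_one (i j : Fin n) : entry e i j 1 = if i = j then 1 else 0 := by
  rw [entry_apply]
  exact orthonormal_iff_ite.1 e.orthonormal i j

/-- The operator with a given diagonal matrix. -/
def diagOp (c : Fin n → ℂ) : E →L[ℂ] E := ofMat e fun i j => if i = j then c i else 0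

lemma entry_diagOp (c : Fin n → ℂ) (i j : Fin n) :
    entry e i j (diagOp e c) = if i = j then c i else 0 := entry_ofMat e _ i j

lemma entry_diagOp_mul (c : Fin n → ℂ) (X : E →L[ℂ] E) (i j : Fin n) :
    entry e i j (diagOp e c * X) = c i * entry e i j X := by
  rw [entry_mul, Finset.sum_eq_single i]
  · rw [entry_diagOp, if_pos rfl]
  · intro l _ hl; rw [entry_diagOp, if_neg (Ne.symm hl), zero_mul]
  · simp

lemma entry_mul_diagOp (c : Fin n → ℂ) (X : E →L[ℂ] E) (i j : Fin n) :
    entry e i j (X * diagOp e c) = entry e i j X * c j := by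
  rw [entry_mul, Finset.sum_eq_single j]
  · rw [entry_diagOp, if_pos rfl]
  · intro l _ hl; rw [entry_diagOp, if_neg hl, mul_zero]
  · simp

lemma diagOp_mul_diagOp (c d : Fin n → ℂ) :
    diagOp e c * diagOp e d = diagOp e (fun i => c i * d i) := by
  refine ext_entry (e := e) fun i j => ?_
  rw [entry_diagOp_mul, entry_diagOp, entry_diagOp]
  split_ifs <;> simp

lemma star_diagOp [CompleteSpace E] (c : Fin n → ℂ) :
    star (diagOp e c) = diagOp e (fun i => star (c i)) := by
  refine ext_entry (e := e) fun i j => ?_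
  rw [entry_star, entry_diagOp, entry_diagOp]
  by_cases h : i = j
  · subst h; simp
  · rw [if_neg h, if_neg (Ne.symm h), star_zero]

lemma diagOp_one : diagOp e (fun _ => 1) = 1 :=
  ext_entry (e := e) fun i j => by rw [entry_diagOp, entry_one]

lemma diagOp_comm (c d : Fin n → ℂ) : diagOp e c * diagOp e d = diagOp e d * diagOp e c := by
  rw [diagOp_mul_diagOp, diagOp_mul_diagOp]
  simp only [mul_comm]

/-- The orthogonal projection to the span of the basis vectors in `J`. -/
def projOp (J : Finset (Fin n)) : E →L[ℂ] E := diagOp e fun i => if i ∈ J then 1 else 0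

lemma star_projOp [CompleteSpace E] (J : Finset (Fin n)) : star (projOp e J) = projOp e J := by
  rw [projOp, star_diagOp]
  congr 1
  ext i
  split_ifs <;> simp

lemma projOp_mul_self (J : Finset (Fin n)) : projOp e J * projOp e J = projOp e J := by
  rw [projOp, diagOp_mul_diagOp]
  congr 1
  ext i
  split_ifs <;> simp

lemma entry_projOp_mul (J : Finset (Fin n)) (X : E →L[ℂ] E) (i j : Fin n) :
    entry e i j (projOp e J * X) = if i ∈ J then entry e i j X else 0 := by
  rw [projOp, entry_diagOp_mul]
  split_ifs <;> simp

lemma entry_mul_projOp (J : Finset (Fin n)) (X : E →L[ℂ] E) (i j : Fin n) :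
    entry e i j (X * projOp e J) = if j ∈ J then entry e i j X else 0 := by
  rw [projOp, entry_mul_diagOp]
  split_ifs <;> simp

lemma entry_projOp (J : Finset (Fin n)) (i j : Fin n) :
    entry e i j (projOp e J) = if i = j ∧ i ∈ J then 1 else 0 := by
  rw [projOp, entry_diagOp]
  by_cases h : i = j <;> simp [h]

/-- The columns of `B` with index in `J` are in reduced echelon form with pivots on the diagonal,
and the other columns vanish. -/
structure IsEchelon (J : Finset (Fin n)) (B : E →L[ℂ] E) : Prop where
  col : ∀ a, ∀ i ∉ J, entry e a i B = 0
  pivot : ∀ a ∈ J, ∀ i ∈ J, entry e a i B = if a = i then 1 else 0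
  upper : ∀ i ∈ J, ∀ a, i < a → entry e a i B = 0

variable {e} {J : Finset (Fin n)} {B : E →L[ℂ] E}

lemma IsEchelon.proj_mul (h : IsEchelon e J B) : projOp e J * B = projOp e J := by
  refine ext_entry (e := e) fun a i => ?_
  rw [entry_projOp_mul, entry_projOp]
  by_cases ha : a ∈ J
  · by_cases hi : i ∈ J
    · simp [ha, h.pivot a ha i hi]
    · have : a ≠ i := fun h' => hi (h' ▸ ha)
      simp [ha, h.col a i hi, this]
  · simp [ha]

lemma IsEchelon.mul_proj (h : IsEchelon e J B) : B * projOp e J = B := by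
  refine ext_entry (e := e) fun a i => ?_
  rw [entry_mul_projOp]
  split_ifs with hi
  · rfl
  · rw [h.col a i hi]

/-! ### The real coordinates of a cell -/

/-- The positions of the complex coordinates of the cell with index set `J`. -/
abbrev CellIndex (J : Finset (Fin n)) : Type := {t : Fin n × Fin n // t.2 ∈ J ∧ t.1 < t.2}

/-- The coordinate space of the cell with index set `J`. -/
abbrev CellSpace (J : Finset (Fin n)) : Type := (CellIndex J → ℂ) × (J → ℝ)

/-- Each pivot i ∈ J carries one complex coordinate for each a < i, an entry of H if a ∈ J and of B
otherwise, and one real coordinate, the diagonal entry of H. Indices start at 0, so 2i+1 is the 2i-1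
of the theorem. -/
lemma finrank_cellSpace (J : Finset (Fin n)) :
    Module.finrank ℝ (CellSpace J) = ∑ i ∈ J, (2 * (i : ℕ) + 1) := by
  have h1 : Fintype.card (CellIndex J) = ∑ i ∈ J, (i : ℕ) := by
    let eqv : CellIndex J ≃ Σ i : J, {a : Fin n // a < i.1} :=
      { toFun := fun t => ⟨⟨t.1.2, t.2.1⟩, ⟨t.1.1, t.2.2⟩⟩
        invFun := fun s => ⟨(s.2.1, s.1.1), s.1.2, s.2.2⟩
        left_inv := fun _ => rfl
        right_inv := fun _ => rfl }
    rw [Fintype.card_congr eqv, Fintype.card_sigma, ← Finset.sum_coe_sort J]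
    refine Finset.sum_congr rfl fun i _ => ?_
    rw [Fintype.card_subtype, ← Fin.card_Iio i.1]
    congr 1
    ext a
    simp
  rw [Module.finrank_prod, Module.finrank_pi_fintype, Module.finrank_pi]
  simp only [Complex.finrank_real_complex, Finset.sum_const, Finset.card_univ, h1,
    Fintype.card_coe, smul_eq_mul, Finset.sum_add_distrib, ← Finset.mul_sum, mul_one]
  ring

/-- The matrix of the coordinate `B`. -/
def cellMatB (w : CellSpace J) (a i : Fin n) : ℂ :=
  if h : i ∈ J ∧ a < i then (if a ∈ J then 0 else w.1 ⟨(a, i), h⟩)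
  else if a = i ∧ i ∈ J then 1 else 0

/-- The matrix of the coordinate `H`. -/
def cellMatH (w : CellSpace J) (a i : Fin n) : ℂ :=
  if h : i ∈ J ∧ a < i then (if a ∈ J then w.1 ⟨(a, i), h⟩ else 0)
  else if h : a ∈ J ∧ i < a then (if i ∈ J then -star (w.1 ⟨(i, a), h⟩) else 0)
  else if h : a = i ∧ i ∈ J then Complex.I * w.2 ⟨i, h.2⟩ else 0

variable (e)

lemma isEchelon_ofMat (w : CellSpace J) : IsEchelon e J (ofMat e (cellMatB w)) where
  col a i hi := by simp [entry_ofMat, cellMatB, hi]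
  pivot a ha i hi := by
    by_cases h : a = i
    · simp [entry_ofMat, cellMatB, hi, h]
    · simp [entry_ofMat, cellMatB, hi, ha, h]
  upper i hi a hia := by simp [entry_ofMat, cellMatB, hi, hia.not_gt, hia.ne']

variable [CompleteSpace E]

lemma isCellPair_ofMat (w : CellSpace J) :
    IsCellPair (projOp e J) (ofMat e (cellMatB w)) (ofMat e (cellMatH w)) where
  mul_left := (isEchelon_ofMat e w).proj_mul
  mul_right := (isEchelon_ofMat e w).mul_proj
  mul_skew := by
    refine ext_entry (e := e) fun a i => ?_
    rw [entry_projOp_mul, entry_ofMat]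
    split_ifs with ha
    · rfl
    · have : ¬ (a = i ∧ i ∈ J) := fun h => ha (h.1 ▸ h.2)
      simp [cellMatH, ha, this]
  star_skew := by
    refine ext_entry (e := e) fun a i => ?_
    rw [entry_star, entry_ofMat, map_neg, entry_ofMat]
    rcases lt_trichotomy a i with h | h | h
    · by_cases ha : a ∈ J <;> by_cases hi : i ∈ J <;> simp [cellMatH, h, h.not_gt, h.ne, h.ne', ha, hi]
    · subst h
      by_cases ha : a ∈ J <;> simp [cellMatH, ha]
    · by_cases ha : a ∈ J <;> by_cases hi : i ∈ J <;> simp [cellMatH, h, h.not_gt, h.ne, h.ne', ha, hi]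

/-- The coordinates of a pair of operators. -/
def cellRead (J : Finset (Fin n)) (B H : E →L[ℂ] E) : CellSpace J :=
  (fun t => if t.1.1 ∈ J then entry e t.1.1 t.1.2 H else entry e t.1.1 t.1.2 B,
    fun i => (entry e i i H).im)

lemma cellRead_ofMat (w : CellSpace J) :
    cellRead e J (ofMat e (cellMatB w)) (ofMat e (cellMatH w)) = w := by
  refine Prod.ext (funext fun t => ?_) (funext fun i => ?_)
  · obtain ⟨⟨a, i⟩, h⟩ := t
    simp only [cellRead, entry_ofMat]
    split_ifs with ha
    · simp [cellMatH, h, ha]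
    · simp [cellMatB, h, ha]
  · simp [cellRead, entry_ofMat, cellMatH]

/-- An echelon B is determined by its entries above the pivots in the rows outside J, and H,
supported on J × J and skew, by its upper triangle and the imaginary parts on its diagonal. -/
lemma ofMat_cellRead {H : E →L[ℂ] E} (hB : IsEchelon e J B) (h : IsCellPair (projOp e J) B H) :
    ofMat e (cellMatB (cellRead e J B H)) = B ∧ ofMat e (cellMatH (cellRead e J B H)) = H := by
  have hrow : ∀ a ∉ J, ∀ i, entry e a i H = 0 := fun a ha i => by
    rw [← h.mul_skew, entry_projOp_mul, if_neg ha]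
  have hskew : ∀ a i, entry e a i H = -star (entry e i a H) := fun a i => by
    have := congrArg (entry e a i) h.star_skew
    rw [entry_star, map_neg] at this
    rw [this, neg_neg]
  have hcol : ∀ i ∉ J, ∀ a, entry e a i H = 0 := fun i hi a => by
    rw [hskew, hrow i hi, star_zero, neg_zero]
  constructor
  · refine ext_entry (e := e) fun a i => ?_
    rw [entry_ofMat, cellMatB]
    by_cases hi : i ∈ J
    swap
    · simp [hi, hB.col a i hi]
    rcases lt_trichotomy a i with hai | hai | hai
    · by_cases ha : a ∈ J
      · simp [hi, hai, ha, hB.pivot a ha i hi, hai.ne]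
      · simp [hi, hai, ha, cellRead]
    · subst hai
      simp [hi, hB.pivot a hi a hi]
    · simp [hai.not_gt, hai.ne', hB.upper i hi a hai]
  · refine ext_entry (e := e) fun a i => ?_
    rw [entry_ofMat, cellMatH]
    by_cases hi : i ∈ J
    swap
    · simp [hi, hcol i hi a]
    by_cases ha : a ∈ J
    swap
    · have : ¬ (a = i) := fun h => ha (h ▸ hi)
      simp [ha, this, hrow a ha i]
    rcases lt_trichotomy a i with hai | hai | hai
    · simp [hi, hai, ha, cellRead]
    · subst hai
      have h1 := congrArg Complex.re (hskew a a)
      have h2 : (entry e a a H).re = 0 := by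
        simp at h1; linarith
      simp only [lt_self_iff_false, and_false, hi, and_self, cellRead, dite_true, dite_false]
      apply Complex.ext <;> simp [h2]
    · simp only [hai.not_gt, hai, hi, ha, cellRead, and_self, and_false, dite_true, dite_false,
        if_true]
      rw [← hskew]

/-! ### The cell as the image of one global chart with a differentiable left inverse -/

variable [FiniteDimensional ℂ E]

/-- The parametrization of the cell with index set `J`. -/
def cellMap (J : Finset (Fin n)) (w : CellSpace J) : E →L[ℂ] E :=
  cellPoint (projOp e J) (ofMat e (cellMatB w)) (ofMat e (cellMatH w))

lemma mem_range_cellMap {U : E →L[ℂ] E} : U ∈ Set.range (cellMap e J) ↔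
    ∃ B H, IsEchelon e J B ∧ IsCellPair (projOp e J) B H ∧ cellPoint (projOp e J) B H = U := by
  constructor
  · rintro ⟨w, rfl⟩
    exact ⟨_, _, isEchelon_ofMat e w, isCellPair_ofMat e w, rfl⟩
  · rintro ⟨B, H, hB, h, rfl⟩
    obtain ⟨h1, h2⟩ := ofMat_cellRead e hB h
    exact ⟨cellRead e J B H, by rw [cellMap, h1, h2]⟩

lemma contDiff_ofMat {W : Type*} [NormedAddCommGroup W] [NormedSpace ℝ W]
    {m : W → Fin n → Fin n → ℂ} (hm : ∀ i j, ContDiff ℝ ∞ fun w => m w i j) :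
    ContDiff ℝ ∞ fun w => ofMat e (m w) := by
  unfold ofMat
  exact ContDiff.sum fun i _ => ContDiff.sum fun j _ => (hm i j).smul contDiff_const

lemma contDiff_cellMatB (a i : Fin n) : ContDiff ℝ ∞ fun w : CellSpace J => cellMatB w a i := by
  unfold cellMatB
  split_ifs <;> fun_prop

lemma contDiff_cellMatH (a i : Fin n) : ContDiff ℝ ∞ fun w : CellSpace J => cellMatH w a i := by
  unfold cellMatH
  split_ifs
  · fun_prop
  · fun_prop
  · refine ContDiff.neg ?_
    exact (starL' ℝ : ℂ ≃L[ℝ] ℂ).contDiff.comp (by fun_prop)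
  · fun_prop
  · refine contDiff_const.mul ?_
    exact Complex.ofRealCLM.contDiff.comp (by fun_prop)
  · fun_prop

lemma contDiff_cellMap (J : Finset (Fin n)) : ContDiff ℝ ∞ (cellMap e J) := by
  have hB := contDiff_ofMat e (contDiff_cellMatB (J := J))
  have hH := contDiff_ofMat e (contDiff_cellMatH (J := J))
  have hBs : ContDiff ℝ ∞ fun w : CellSpace J => star (ofMat e (cellMatB w)) :=
    (starL' ℝ : (E →L[ℂ] E) ≃L[ℝ] (E →L[ℂ] E)).contDiff.comp hB
  have hK : ContDiff ℝ ∞ fun w : CellSpace J =>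
      cellK (projOp e J) (ofMat e (cellMatB w)) (ofMat e (cellMatH w)) :=
    (((hBs.mul hB).const_smul _).add hH).add contDiff_const
  have hL : ContDiff ℝ ∞ fun w : CellSpace J =>
      Ring.inverse (cellK (projOp e J) (ofMat e (cellMatB w)) (ofMat e (cellMatH w))) := by
    rw [contDiff_iff_contDiffAt]
    intro w
    obtain ⟨u, hu⟩ := (isCellPair_ofMat e w).isUnit_cellK (star_projOp e J) (projOp_mul_self e J)
    exact ContDiffAt.comp w (hu ▸ contDiffAt_ringInverse ℝ u) hK.contDiffAt
  exact contDiff_const.sub ((hB.mul hL).mul hBs)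

/-- The left inverse of the parametrization of a cell. -/
def cellInv (J : Finset (Fin n)) (U : E →L[ℂ] E) : CellSpace J :=
  let K := Ring.inverse (projOp e J * (1 - U) * projOp e J + (1 - projOp e J))
  let B := (1 - U) * projOp e J * K
  cellRead e J B (K - (1 - projOp e J) - (2⁻¹ : ℂ) • (star B * B))

lemma cellInv_cellMap (w : CellSpace J) : cellInv e J (cellMap e J w) = w := by
  have h := isCellPair_ofMat e w
  have hP := star_projOp e J
  have hPP := projOp_mul_self e J
  have h1 : cellK (projOp e J) (ofMat e (cellMatB w)) (ofMat e (cellMatH w)) - (1 - projOp e J) -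
      (2⁻¹ : ℂ) • (star (ofMat e (cellMatB w)) * ofMat e (cellMatB w)) =
      ofMat e (cellMatH w) := by
    rw [cellK]; abel
  simp only [cellInv, cellMap]
  rw [h.inverse_compress hP hPP, h.mul_cellK hP hPP, h1, cellRead_ofMat]

/-- The domain of the left inverse of the parametrization of a cell. -/
def cellDomain (J : Finset (Fin n)) : Set (E →L[ℂ] E) :=
  {U | IsUnit (projOp e J * (1 - U) * projOp e J + (1 - projOp e J))}

lemma isOpen_cellDomain (J : Finset (Fin n)) : IsOpen (cellDomain e J) :=
  Units.isOpen.preimage (f := fun U : E →L[ℂ] E =>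
    projOp e J * (1 - U) * projOp e J + (1 - projOp e J)) (by fun_prop)

lemma cellMap_mem_cellDomain (w : CellSpace J) : cellMap e J w ∈ cellDomain e J :=
  (isCellPair_ofMat e w).isUnit_compress (star_projOp e J) (projOp_mul_self e J)

lemma differentiableOn_cellInv (J : Finset (Fin n)) :
    DifferentiableOn ℝ (cellInv e J) (cellDomain e J) := by
  intro U hU
  have hK : DifferentiableAt ℝ (fun U : E →L[ℂ] E =>
      Ring.inverse (projOp e J * (1 - U) * projOp e J + (1 - projOp e J))) U := by
    obtain ⟨u, hu⟩ := hU
    have h1 : DifferentiableAt ℝ Ring.inverse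
        (projOp e J * (1 - U) * projOp e J + (1 - projOp e J)) := by
      rw [← hu]; exact (hasFDerivAt_ringInverse u).differentiableAt
    exact DifferentiableAt.comp (f := fun U : E →L[ℂ] E =>
      projOp e J * (1 - U) * projOp e J + (1 - projOp e J)) U h1 (by fun_prop)
  have hB : DifferentiableAt ℝ (fun U : E →L[ℂ] E => (1 - U) * projOp e J *
      Ring.inverse (projOp e J * (1 - U) * projOp e J + (1 - projOp e J))) U :=
    DifferentiableAt.mul (by fun_prop) hK
  have hBs := (starL' ℝ : (E →L[ℂ] E) ≃L[ℝ] (E →L[ℂ] E)).differentiableAt.comp U hB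
  have hH := (hK.sub (differentiableAt_const (1 - projOp e J))).sub
    ((hBs.mul hB).const_smul (2⁻¹ : ℂ))
  have hent : ∀ {f : (E →L[ℂ] E) → (E →L[ℂ] E)}, DifferentiableAt ℝ f U → ∀ i j,
      DifferentiableAt ℝ (fun U => entry e i j (f U)) U := fun hf i j =>
    ((entry e i j).restrictScalars ℝ).differentiableAt.comp U hf
  refine DifferentiableAt.differentiableWithinAt (DifferentiableAt.prodMk ?_ ?_)
  · rw [differentiableAt_pi]
    intro t
    by_cases ht : t.1.1 ∈ J
    · exact (hent hH _ _).congr_of_eventuallyEq (Eventually.of_forall fun U => if_pos ht)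
    · exact (hent hB _ _).congr_of_eventuallyEq (Eventually.of_forall fun U => if_neg ht)
  · rw [differentiableAt_pi]
    intro i
    exact Complex.imCLM.differentiableAt.comp U (hent hH _ _)

/-- A single chart covers the cell, so orientability is automatic. -/
lemma nonempty_orientedAtlas_range_cellMap (J : Finset (Fin n)) {d : ℕ}
    (hd : d = ∑ i ∈ J, (2 * (i : ℕ) + 1)) :
    Nonempty (OrientedAtlas (Set.range (cellMap e J)) d) := by
  let Λ : (Fin d → ℝ) ≃L[ℝ] CellSpace J :=
    ContinuousLinearEquiv.ofFinrankEq (by rw [finrank_cellSpace, ← hd]; simp)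
  have h1 : Set.range (cellMap e J) = Set.range fun x => cellMap e J (Λ x) :=
    (Λ.surjective.range_comp (cellMap e J)).symm
  rw [h1]
  let f := Param.ofLeftInverse (fun x => cellMap e J (Λ x))
    ((contDiff_cellMap e J).comp Λ.contDiff) (cellDomain e J) (isOpen_cellDomain e J)
    (fun x => cellMap_mem_cellDomain e (Λ x)) (fun U => Λ.symm (cellInv e J U))
    (fun U hU => Λ.symm.differentiableAt.comp_differentiableWithinAt U
      (differentiableOn_cellInv e J U hU))
    (fun x => by simp [cellInv_cellMap])
  exact ⟨f.toOrientedAtlas (by rintro _ ⟨x, rfl⟩; exact ⟨x, Set.mem_univ x, rfl⟩)⟩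

end Coordinates

/-! ### The flow lines which tend to a critical point -/

section Flow

variable {E : Type*} [NormedAddCommGroup E] [InnerProductSpace ℂ E]
  {n : ℕ} (e : OrthonormalBasis (Fin n) ℂ E)

lemma tendsto_of_entry {β : Type*} {l : Filter β} {f : β → E →L[ℂ] E} {X : E →L[ℂ] E}
    (h : ∀ i j, Tendsto (fun t => entry e i j (f t)) l (𝓝 (entry e i j X))) :
    Tendsto f l (𝓝 X) := by
  have h1 : f = fun t => ofMat e (fun i j => entry e i j (f t)) :=
    funext fun t => (ofMat_entry e (f t)).symm
  rw [h1, ← ofMat_entry e X]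
  unfold ofMat
  exact tendsto_finsetSum _ fun i _ => tendsto_finsetSum _ fun j _ => (h i j).smul_const _

lemma hasDerivAt_diagOp {c : ℝ → Fin n → ℂ} {c' : Fin n → ℂ} {t : ℝ}
    (h : ∀ i, HasDerivAt (fun s => c s i) (c' i) t) :
    HasDerivAt (fun s => diagOp e (c s)) (diagOp e c') t := by
  unfold diagOp ofMat
  refine HasDerivAt.fun_sum fun i _ => HasDerivAt.fun_sum fun j _ => ?_
  have h1 : HasDerivAt (fun s => if i = j then c s i else 0) (if i = j then c' i else 0) t := by
    split_ifs
    · exact h i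
    · exact hasDerivAt_const _ _
  exact h1.smul_const (InnerProductSpace.rankOne ℂ (e i) (e j))

/-- The operator with eigenvalues `1, …, n` on the basis vectors. -/
def weightOp : E →L[ℂ] E := diagOp e fun i => (i : ℕ) + 1

/-- The one-parameter group generated by `weightOp`. -/
def expOp (t : ℝ) : E →L[ℂ] E := diagOp e fun i => (Real.exp (t * ((i : ℕ) + 1)) : ℝ)

lemma hasDerivAt_expOp (t : ℝ) : HasDerivAt (expOp e) (weightOp e * expOp e t) t := by
  unfold expOp weightOp
  rw [diagOp_mul_diagOp]
  refine hasDerivAt_diagOp e fun i => ?_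
  have h1 : HasDerivAt (fun s : ℝ => Real.exp (s * ((i : ℕ) + 1)))
      (Real.exp (t * ((i : ℕ) + 1)) * (1 * ((i : ℕ) + 1))) t :=
    ((hasDerivAt_id t).mul_const _).exp
  convert h1.ofReal_comp using 1
  push_cast
  ring

lemma hasDerivAt_expOp_neg (t : ℝ) :
    HasDerivAt (fun s => expOp e (-s)) (-(weightOp e * expOp e (-t))) t := by
  refine ((hasDerivAt_expOp e (-t)).scomp t (hasDerivAt_neg t)).congr_deriv ?_
  simp

lemma expOp_mul_neg (t : ℝ) : expOp e t * expOp e (-t) = 1 := by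
  rw [expOp, expOp, diagOp_mul_diagOp, ← diagOp_one e]
  congr 1
  ext i
  rw [← Complex.ofReal_mul, ← Real.exp_add]
  simp

lemma expOp_neg_mul (t : ℝ) : expOp e (-t) * expOp e t = 1 := by
  have := expOp_mul_neg e (-t)
  rwa [neg_neg] at this

lemma expOp_zero : expOp e 0 = 1 := by
  rw [expOp, ← diagOp_one e]
  simp

lemma star_expOp [CompleteSpace E] (t : ℝ) : star (expOp e t) = expOp e t := by
  rw [expOp, star_diagOp]
  congr 1
  ext i
  exact Complex.conj_ofReal _

lemma star_weightOp [CompleteSpace E] : star (weightOp e) = weightOp e := by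
  rw [weightOp, star_diagOp]
  simp

lemma weightOp_expOp (t : ℝ) : weightOp e * expOp e t = expOp e t * weightOp e :=
  diagOp_comm e _ _

lemma projOp_expOp (J : Finset (Fin n)) (t : ℝ) :
    projOp e J * expOp e t = expOp e t * projOp e J :=
  diagOp_comm e _ _

lemma entry_expOp_mul (t : ℝ) (X : E →L[ℂ] E) (i j : Fin n) :
    entry e i j (expOp e t * X) = (Real.exp (t * ((i : ℕ) + 1)) : ℝ) * entry e i j X :=
  entry_diagOp_mul e _ _ _ _

lemma entry_mul_expOp (t : ℝ) (X : E →L[ℂ] E) (i j : Fin n) :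
    entry e i j (X * expOp e t) = entry e i j X * (Real.exp (t * ((j : ℕ) + 1)) : ℝ) :=
  entry_mul_diagOp e _ _ _ _

lemma tendsto_exp_mul_atBot {c : ℝ} (hc : 0 < c) :
    Tendsto (fun t : ℝ => ((Real.exp (t * c) : ℝ) : ℂ)) atBot (𝓝 0) := by
  have h1 : Tendsto (fun t : ℝ => Real.exp (t * c)) atBot (𝓝 0) :=
    Real.tendsto_exp_atBot.comp (tendsto_id.atBot_mul_const hc)
  exact_mod_cast (Complex.continuous_ofReal.tendsto 0).comp h1

/-! ### The flow is linear in the coordinates of a cell -/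

variable [CompleteSpace E] [FiniteDimensional ℂ E] {J : Finset (Fin n)} {B H : E →L[ℂ] E}

lemma isCellPair_projOp_zero : IsCellPair (projOp e J) (projOp e J) 0 :=
  ⟨projOp_mul_self e J, projOp_mul_self e J, mul_zero _, by simp⟩

lemma cellPoint_projOp_zero :
    cellPoint (projOp e J) (projOp e J) 0 = 1 - (2 : ℂ) • projOp e J := by
  have hP := star_projOp e J
  have hPP := projOp_mul_self e J
  have h := isCellPair_projOp_zero e (J := J)
  have h1 : cellK (projOp e J) (projOp e J) 0 * projOp e J = (2⁻¹ : ℂ) • projOp e J := by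
    rw [cellK, hP, hPP, add_zero, add_mul, smul_mul_assoc, hPP, sub_mul, hPP]
    simp
  have h2 : (2 : ℂ) • projOp e J =
      Ring.inverse (cellK (projOp e J) (projOp e J) 0) * projOp e J := by
    have h3 := congrArg
      (fun X => (2 : ℂ) • (Ring.inverse (cellK (projOp e J) (projOp e J) 0) * X)) h1
    simp only [← mul_assoc, Ring.inverse_mul_cancel _ (h.isUnit_cellK hP hPP), mul_smul_comm,
      one_mul] at h3
    rw [h3, smul_smul]
    simp
  rw [cellPoint, hP, mul_assoc, ← h2, mul_smul_comm, hPP]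

lemma IsCellPair.expOp (h : IsCellPair (projOp e J) B H) (t : ℝ) :
    IsCellPair (projOp e J) (expOp e (-t) * B * expOp e t) (expOp e t * H * expOp e t) where
  mul_left := by
    rw [← mul_assoc, ← mul_assoc, projOp_expOp, mul_assoc _ (projOp e J), h.mul_left, mul_assoc,
      projOp_expOp, ← mul_assoc, expOp_neg_mul, one_mul]
  mul_right := by rw [mul_assoc, ← projOp_expOp, ← mul_assoc, mul_assoc _ B, h.mul_right]
  mul_skew := by
    rw [← mul_assoc, ← mul_assoc, projOp_expOp, mul_assoc _ (projOp e J), h.mul_skew]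
  star_skew := by
    rw [star_mul, star_mul, star_expOp, h.star_skew, neg_mul, mul_neg, mul_assoc]

/-- With Q = 1 - U the field is AQ + QA - QAQ. The linear equations for B and H give K₀' = AK₀ + K₀A
- B^*AB for K₀ = K - (1 - P), and the term B^*AB, placed between B K⁻¹ and K⁻¹ B^*, becomes QAQ. -/
lemma hasDerivAt_cellPoint {P A : E →L[ℂ] E} (hP : star P = P) (hPP : P * P = P)
    (hA : star A = A) {b η : ℝ → E →L[ℂ] E} {t : ℝ} (ht : IsCellPair P (b t) (η t))
    (db : HasDerivAt b (-(A * b t) + b t * A) t) (dη : HasDerivAt η (A * η t + η t * A) t) :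
    HasDerivAt (fun s => cellPoint P (b s) (η s))
      (A - cellPoint P (b t) (η t) * A * cellPoint P (b t) (η t)) t := by
  have hu := ht.isUnit_cellK hP hPP
  have dbs : HasDerivAt (fun s => star (b s)) (-(star (b t) * A) + A * star (b t)) t :=
    db.star.congr_deriv (by rw [star_add, star_neg, star_mul, star_mul, hA])
  set K := cellK P (b t) (η t) with hK
  have dK : HasDerivAt (fun s => cellK P (b s) (η s)) (A * (K - (1 - P)) + (K - (1 - P)) * A -
      star (b t) * A * b t) t := by
    refine ((((dbs.fun_mul db).const_smul (2⁻¹ : ℂ)).add dη).add_const (1 - P)).congr_deriv ?_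
    rw [hK, cellK, add_sub_cancel_right]
    simp only [mul_add, add_mul, mul_neg, neg_mul, mul_smul_comm, smul_mul_assoc, smul_add,
      smul_neg, mul_assoc]
    module
  set L := Ring.inverse K with hL
  have dL : HasDerivAt (fun s => Ring.inverse (cellK P (b s) (η s)))
      (-(L * (A * (K - (1 - P)) + (K - (1 - P)) * A - star (b t) * A * b t) * L)) t := by
    obtain ⟨u, hu'⟩ := hu
    have h1 : HasFDerivAt Ring.inverse
        (-((ContinuousLinearMap.mulLeftRight ℝ (E →L[ℂ] E)) ↑u⁻¹) ↑u⁻¹) (cellK P (b t) (η t)) :=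
      by rw [← hK, ← hu']; exact hasFDerivAt_ringInverse (𝕜 := ℝ) u
    have h2 := h1.comp_hasDerivAt t dK
    have h3 : (↑u⁻¹ : E →L[ℂ] E) = L := by rw [hL, ← hu', Ring.inverse_unit]
    rw [h3] at h2
    exact h2
  refine (((db.fun_mul dL).fun_mul dbs).const_sub 1).congr_deriv ?_
  have e3 : cellPoint P (b t) (η t) = 1 - b t * L * star (b t) := rfl
  rw [e3]
  have hKL : K * L = 1 := Ring.mul_inverse_cancel _ hu
  have hLK : L * K = 1 := Ring.inverse_mul_cancel _ hu
  have hbP : b t * (1 - P) = 0 := by rw [mul_sub, mul_one, ht.mul_right, sub_self]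
  have hbL : b t * L * (1 - P) = 0 := by rw [mul_assoc, ht.inverse_mul_compl hP hPP, hbP]
  have hbs : (1 - P) * star (b t) = 0 := by
    have := congrArg star hbP
    rwa [star_mul, star_sub, star_one, hP, star_zero] at this
  have hLb : (1 - P) * L * star (b t) = 0 := by rw [ht.compl_mul_inverse hP hPP, hbs]
  rw [← hK, ← hL]
  generalize b t = β at *
  have e1 : β * (L * (A * (K - (1 - P)) + (K - (1 - P)) * A - star β * A * β) * L) * star β =
      β * L * A * star β + β * A * L * star β -
        (β * L * star β) * A * (β * L * star β) := by
    have e2 : β * (L * (A * (K - (1 - P)) + (K - (1 - P)) * A - star β * A * β) * L) * star β =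
        β * L * A * (K * L) * star β - β * L * A * ((1 - P) * L * star β) +
        (β * (L * K) * A * L * star β - (β * L * (1 - P)) * A * L * star β) -
        (β * L * star β) * A * (β * L * star β) := by
      simp only [mul_add, add_mul, mul_sub, sub_mul, mul_assoc]
    rw [e2, hKL, hLK, hLb, hbL]
    simp
  rw [mul_neg, add_mul _ (-_), neg_mul _ (star β), e1]
  simp only [mul_add, add_mul, mul_sub, sub_mul, mul_neg, neg_mul, mul_assoc, mul_one, one_mul]
  abel

lemma hasDerivAt_cellPoint_expOp (h : IsCellPair (projOp e J) B H) (t : ℝ) :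
    HasDerivAt (fun s => cellPoint (projOp e J) (expOp e (-s) * B * expOp e s)
        (expOp e s * H * expOp e s))
      (weightOp e - cellPoint (projOp e J) (expOp e (-t) * B * expOp e t)
        (expOp e t * H * expOp e t) * weightOp e * cellPoint (projOp e J)
        (expOp e (-t) * B * expOp e t) (expOp e t * H * expOp e t)) t := by
  refine hasDerivAt_cellPoint (star_projOp e J) (projOp_mul_self e J) (star_weightOp e)
    (h.expOp e t) ?_ ?_
  · refine (((hasDerivAt_expOp_neg e t).mul_const B).fun_mul
      (hasDerivAt_expOp e t)).congr_deriv ?_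
    rw [weightOp_expOp e t]
    simp only [neg_mul, mul_assoc]
  · refine (((hasDerivAt_expOp e t).mul_const H).fun_mul (hasDerivAt_expOp e t)).congr_deriv ?_
    have : expOp e t * H * expOp e t * weightOp e = expOp e t * H * (weightOp e * expOp e t) := by
      rw [weightOp_expOp]; simp only [mul_assoc]
    rw [this]
    simp only [mul_assoc]

/-- The entries (a, i) of B and H are scaled by e^{s(i-a)} and e^{s(a+i+2)}. As s → -∞ the echelon
form leaves only the pivots of B, and H tends to 0. -/
lemma tendsto_cellPoint_expOp (hB : IsEchelon e J B) :
    Tendsto (fun s => cellPoint (projOp e J) (expOp e (-s) * B * expOp e s)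
      (expOp e s * H * expOp e s)) atBot (𝓝 (1 - (2 : ℂ) • projOp e J)) := by
  have hP := star_projOp e J
  have hPP := projOp_mul_self e J
  have tB : Tendsto (fun s => expOp e (-s) * B * expOp e s) atBot (𝓝 (projOp e J)) := by
    refine tendsto_of_entry e fun a i => ?_
    have h1 : ∀ s, entry e a i (expOp e (-s) * B * expOp e s) =
        entry e a i B * (Real.exp (s * ((i : ℕ) - (a : ℕ) : ℝ)) : ℝ) := fun s => by
      rw [entry_mul_expOp, entry_expOp_mul, mul_comm _ (entry e a i B), mul_assoc,
        ← Complex.ofReal_mul, ← Real.exp_add]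
      congr 4
      ring
    simp only [h1]
    rw [← hB.proj_mul, entry_projOp_mul]
    by_cases hi : i ∈ J
    swap
    · simp [hB.col a i hi]
    rcases lt_trichotomy a i with hai | hai | hai
    · have h2 := (tendsto_exp_mul_atBot (c := ((i : ℕ) - (a : ℕ) : ℝ))
        (by rw [sub_pos]; exact_mod_cast hai)).const_mul (entry e a i B)
      rw [mul_zero] at h2
      convert h2 using 2
      split_ifs with ha
      · rw [hB.pivot a ha i hi, if_neg hai.ne]
      · rfl
    · subst hai
      simp [hi]
    · simp [hB.upper i hi a hai]
  have tH : Tendsto (fun s => expOp e s * H * expOp e s) atBot (𝓝 0) := by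
    refine tendsto_of_entry e fun a i => ?_
    have h1 : ∀ s, entry e a i (expOp e s * H * expOp e s) =
        entry e a i H * (Real.exp (s * ((a : ℕ) + 1 + ((i : ℕ) + 1) : ℝ)) : ℝ) := fun s => by
      rw [entry_mul_expOp, entry_expOp_mul, mul_comm _ (entry e a i H), mul_assoc,
        ← Complex.ofReal_mul, ← Real.exp_add, mul_add s ((a : ℕ) + 1 : ℝ)]
    simp only [h1]
    have h2 := (tendsto_exp_mul_atBot (c := ((a : ℕ) + 1 + ((i : ℕ) + 1) : ℝ))
      (by positivity)).const_mul (entry e a i H)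
    simpa using h2
  have tBs := tB.star
  have tK : Tendsto (fun s => cellK (projOp e J) (expOp e (-s) * B * expOp e s)
      (expOp e s * H * expOp e s)) atBot (𝓝 (cellK (projOp e J) (projOp e J) 0)) :=
    (((tBs.mul tB).const_smul (2⁻¹ : ℂ)).add tH).add_const _
  have hinv : ContinuousAt Ring.inverse (cellK (projOp e J) (projOp e J) 0) := by
    obtain ⟨u, hu⟩ := (isCellPair_projOp_zero e (J := J)).isUnit_cellK hP hPP
    rw [← hu]
    exact (hasFDerivAt_ringInverse (𝕜 := ℝ) u).continuousAt
  have tL := hinv.tendsto.comp tK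
  rw [← cellPoint_projOp_zero]
  exact ((tB.mul tL).mul tBs).const_sub 1

lemma exists_flowLine (hB : IsEchelon e J B) (h : IsCellPair (projOp e J) B H) :
    ∃ γ : ℝ → E →L[ℂ] E, (∀ t, γ t ∈ unitary (E →L[ℂ] E)) ∧
      (∀ t, HasDerivAt γ (weightOp e - γ t * weightOp e * γ t) t) ∧
      γ 0 = cellPoint (projOp e J) B H ∧
      Tendsto γ atBot (𝓝 (1 - (2 : ℂ) • projOp e J)) := by
  refine ⟨_, fun t => (h.expOp e t).cellPoint_mem_unitary (star_projOp e J) (projOp_mul_self e J),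
    hasDerivAt_cellPoint_expOp e h, ?_, tendsto_cellPoint_expOp e hB⟩
  simp [expOp_zero]

/-- The flow of `U ↦ A - U A U`, linearized by a Cayley transform. -/
lemma flow_mul_eq {γ : ℝ → E →L[ℂ] E} (hγ : ∀ t, γ t ∈ unitary (E →L[ℂ] E))
    (hd : ∀ t, HasDerivAt γ (weightOp e - γ t * weightOp e * γ t) t) (t : ℝ) :
    (1 - γ t) * (expOp e t - (2⁻¹ : ℂ) • (expOp e t - expOp e (-t)) * (1 - γ 0)) =
      expOp e (-t) * (1 - γ 0) := by
  set A := weightOp e with hA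
  set Q₀ := 1 - γ 0 with hQ₀
  -- The claim is γ_t = (sinh tA + cosh tA γ_0)(cosh tA + sinh tA γ_0)⁻¹, written for 1 - γ_t and
  -- cleared of its denominator. The defect G solves the linear equation G' = -γAG with G(0) = 0.
  set G : ℝ → E →L[ℂ] E := fun t =>
    (1 - γ t) * (expOp e t - (2⁻¹ : ℂ) • (expOp e t - expOp e (-t)) * Q₀) - expOp e (-t) * Q₀
    with hG
  have hGd : ∀ t, HasDerivAt G (-(γ t * A) * G t) t := by
    intro t
    have dD := hasDerivAt_expOp e t
    have dD' := hasDerivAt_expOp_neg e t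
    have dN := dD.sub (((dD.sub dD').const_smul (2⁻¹ : ℂ)).mul_const Q₀)
    refine ((((hd t).const_sub 1).fun_mul dN).sub (dD'.mul_const Q₀)).congr_deriv ?_
    simp only [← hA, hG]
    simp only [Pi.sub_apply, Pi.smul_apply, mul_sub, sub_mul, mul_neg, neg_mul, smul_sub,
      smul_neg, mul_smul_comm, smul_mul_assoc, mul_assoc, one_mul]
    module
  have hn : ∀ t, ‖γ t‖ ≤ 1 := by
    intro t
    -- Unitaries have norm one only in a nontrivial algebra. The bound makes ‖A‖ a Lipschitz
    -- constant for all times.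
    rcases subsingleton_or_nontrivial (E →L[ℂ] E) with hs | hs
    · rw [Subsingleton.elim (γ t) 0, norm_zero]; exact zero_le_one
    · exact (CStarRing.norm_of_mem_unitary (hγ t)).le
  have hG0 : G = fun _ => 0 := by
    refine ODE_solution_unique_univ (v := fun t X => -(γ t * A) * X) (s := fun _ => Set.univ)
      (K := ‖A‖₊) (t₀ := 0) ?_ (fun t => ⟨hGd t, Set.mem_univ _⟩)
      (fun t => ⟨by simpa using hasDerivAt_const t (0 : E →L[ℂ] E), Set.mem_univ _⟩) ?_
    · intro t
      refine LipschitzWith.lipschitzOnWith (LipschitzWith.of_dist_le_mul fun X Y => ?_)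
      rw [dist_eq_norm, dist_eq_norm, ← mul_sub]
      refine (norm_mul_le _ _).trans (mul_le_mul_of_nonneg_right ?_ (norm_nonneg _))
      rw [norm_neg, coe_nnnorm]
      exact (norm_mul_le _ _).trans (mul_le_of_le_one_left (norm_nonneg _) (hn t))
    · simp [hG, expOp_zero]
      exact sub_self _
  exact sub_eq_zero.1 (congrFun hG0 t)

end Flow

/-! ### Backward convergence forces the cell form -/

section Backward

variable {E : Type*} [NormedAddCommGroup E] [InnerProductSpace ℂ E] [CompleteSpace E]
  [FiniteDimensional ℂ E] {n : ℕ} (e : OrthonormalBasis (Fin n) ℂ E) {J : Finset (Fin n)}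

/-- If the flow line through `γ 0` tends to the critical point with index set `J` as `t → -∞`, then
the last nonzero coordinate of each vector in the range of `1 - γ 0` has its index in `J`. -/
lemma exists_mem_entry_ne_zero {γ : ℝ → E →L[ℂ] E} (hγ : ∀ t, γ t ∈ unitary (E →L[ℂ] E))
    (hd : ∀ t, HasDerivAt γ (weightOp e - γ t * weightOp e * γ t) t)
    (hlim : Tendsto γ atBot (𝓝 (1 - (2 : ℂ) • projOp e J))) (X : E →L[ℂ] E) (l j : Fin n)
    (hl : entry e l j ((1 - γ 0) * X) ≠ 0) :
    ∃ l' ∈ J, l ≤ l' ∧ entry e l' j ((1 - γ 0) * X) ≠ 0 := by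
  classical
  set W := (1 - γ 0) * X with hW
  obtain ⟨l', hl', hmax⟩ := (Finset.univ.filter fun b => entry e b j W ≠ 0).exists_max_image id
    ⟨l, by simpa using hl⟩
  rw [Finset.mem_filter] at hl'
  refine ⟨l', ?_, hmax l (by simpa using hl), hl'.2⟩
  by_contra hJ
  refine hl'.2 ?_
  have hbig : ∀ b, l' < b → entry e b j W = 0 := by
    intro b hb
    by_contra h
    exact absurd (hmax b (by simpa using h)) (not_le.2 hb)
  -- Row l' of `flow_mul_eq` applied to X, scaled by e^{t(l'+1)}. If l' ∉ J, row l' of 1 - γ_t tends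
  -- to 0. The other factors converge, since e^{t(l'-b)} occurs only with b ≤ l', the entries of W
  -- beyond l' being zero. Hence the entry at l' is zero.
  have h1 : ∀ t, ∑ b : Fin n, entry e l' b (1 - γ t) *
      ((Real.exp (t * ((l' : ℕ) + 1)) : ℝ) * ((Real.exp (t * ((b : ℕ) + 1)) : ℝ) * entry e b j X -
        2⁻¹ * (((Real.exp (t * ((b : ℕ) + 1)) : ℝ) - (Real.exp (-t * ((b : ℕ) + 1)) : ℝ)) *
          entry e b j W))) = entry e l' j W := by
    intro t
    have h2 := congrArg (fun Y => (Real.exp (t * ((l' : ℕ) + 1)) : ℝ) * entry e l' j (Y * X))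
      (flow_mul_eq e hγ hd t)
    have h3 : ((Real.exp (t * ((l' : ℕ) + 1)) : ℝ) : ℂ) *
        entry e l' j (expOp e (-t) * (1 - γ 0) * X) = entry e l' j W := by
      rw [mul_assoc, ← hW, entry_expOp_mul, ← mul_assoc, ← Complex.ofReal_mul, ← Real.exp_add]
      simp
    rw [h3, mul_assoc, entry_mul, Finset.mul_sum] at h2
    rw [← h2]
    refine Finset.sum_congr rfl fun b _ => ?_
    have h4 : (expOp e t - (2⁻¹ : ℂ) • (expOp e t - expOp e (-t)) * (1 - γ 0)) * X =
        expOp e t * X - (2⁻¹ : ℂ) • (expOp e t * W - expOp e (-t) * W) := by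
      rw [hW]
      simp only [sub_mul, smul_mul_assoc, mul_assoc]
    rw [h4, map_sub (entry e b j), map_smul, map_sub (entry e b j), entry_expOp_mul, entry_expOp_mul, entry_expOp_mul,
      smul_eq_mul]
    ring
  have hQ : ∀ b, Tendsto (fun t => entry e l' b (1 - γ t)) atBot (𝓝 0) := by
    intro b
    have h2 := ((entry e l' b).continuous.tendsto _).comp (hlim.const_sub 1)
    rw [sub_sub_cancel, map_smul, entry_projOp, if_neg (fun h => hJ h.2), smul_zero] at h2
    exact h2
  have hbr : ∀ b : Fin n, ∃ c, Tendsto (fun t : ℝ => ((Real.exp (t * ((l' : ℕ) + 1)) : ℝ) : ℂ) *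
      ((Real.exp (t * ((b : ℕ) + 1)) : ℝ) * entry e b j X -
        2⁻¹ * (((Real.exp (t * ((b : ℕ) + 1)) : ℝ) - (Real.exp (-t * ((b : ℕ) + 1)) : ℝ)) *
          entry e b j W))) atBot (𝓝 c) := by
    intro b
    have h2 : ∀ t : ℝ, ((Real.exp (t * ((l' : ℕ) + 1)) : ℝ) : ℂ) *
      ((Real.exp (t * ((b : ℕ) + 1)) : ℝ) * entry e b j X -
        2⁻¹ * (((Real.exp (t * ((b : ℕ) + 1)) : ℝ) - (Real.exp (-t * ((b : ℕ) + 1)) : ℝ)) *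
          entry e b j W)) =
        (Real.exp (t * ((l' : ℕ) + 1 + ((b : ℕ) + 1))) : ℝ) *
          (entry e b j X - 2⁻¹ * entry e b j W) +
        (Real.exp (t * ((l' : ℕ) - (b : ℕ) : ℝ)) : ℝ) * (2⁻¹ * entry e b j W) := by
      intro t
      have h3 : Real.exp (t * ((l' : ℕ) + 1 + ((b : ℕ) + 1))) =
          Real.exp (t * ((l' : ℕ) + 1)) * Real.exp (t * ((b : ℕ) + 1)) := by
        rw [← Real.exp_add, ← mul_add]
      have h4 : Real.exp (t * ((l' : ℕ) - (b : ℕ) : ℝ)) =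
          Real.exp (t * ((l' : ℕ) + 1)) * Real.exp (-t * ((b : ℕ) + 1)) := by
        rw [← Real.exp_add]; ring_nf
      rw [h3, h4]
      push_cast
      ring
    simp only [h2]
    have h5 := (tendsto_exp_mul_atBot (c := ((l' : ℕ) + 1 + ((b : ℕ) + 1) : ℝ))
      (by positivity)).mul_const (entry e b j X - 2⁻¹ * entry e b j W)
    rcases lt_trichotomy b l' with hb | hb | hb
    · exact ⟨_, h5.add ((tendsto_exp_mul_atBot (c := ((l' : ℕ) - (b : ℕ) : ℝ))
        (by rw [sub_pos]; exact_mod_cast hb)).mul_const _)⟩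
    · subst hb
      simp only [sub_self, mul_zero]
      exact ⟨_, h5.add tendsto_const_nhds⟩
    · simp only [hbig b hb, mul_zero, add_zero, sub_zero] at h5 ⊢
      exact ⟨_, h5⟩
  choose c hc using hbr
  have h6 := tendsto_finsetSum Finset.univ fun b _ => (hQ b).mul (hc b)
  simp only [h1, zero_mul, Finset.sum_const_zero] at h6
  exact tendsto_nhds_unique tendsto_const_nhds h6

/-- Leading coordinates in J make P injective on the range of Q = 1 - γ_0. Near the critical point
the compression of 1 - γ_t is invertible, so P maps this range onto its own range. Column reduction
then gives the echelon matrix B of the range. -/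
lemma mem_range_cellMap_of_flowLine {γ : ℝ → E →L[ℂ] E} (hγ : ∀ t, γ t ∈ unitary (E →L[ℂ] E))
    (hd : ∀ t, HasDerivAt γ (weightOp e - γ t * weightOp e * γ t) t)
    (hlim : Tendsto γ atBot (𝓝 (1 - (2 : ℂ) • projOp e J))) :
    γ 0 ∈ Set.range (cellMap e J) := by
  have hlead := exists_mem_entry_ne_zero e hγ hd hlim
  have hflow := flow_mul_eq e hγ hd
  set P := projOp e J with hPdef
  have hP : star P = P := star_projOp e J
  have hPP : P * P = P := projOp_mul_self e J
  have hPP0 : P * (1 - P) = 0 := by rw [mul_sub, mul_one, hPP, sub_self]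
  have hPP1 : (1 - P) * P = 0 := by rw [sub_mul, one_mul, hPP, sub_self]
  have hPP2 : (1 - P) * (1 - P) = 1 - P := by rw [mul_sub, mul_one, hPP1, sub_zero]
  set Q := 1 - γ 0 with hQ
  have hzero : ∀ X, P * (Q * X) = 0 → Q * X = 0 := by
    intro X hX
    refine ext_entry (e := e) fun l j => ?_
    rw [map_zero]
    by_contra h
    obtain ⟨l', hl', -, h'⟩ := hlead X l j h
    refine h' ?_
    have := congrArg (entry e l' j) hX
    rwa [hPdef, entry_projOp_mul, if_pos hl', map_zero] at this
  obtain ⟨t, ht⟩ : ∃ t, γ t ∈ cellDomain e J := by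
    have h1 : (1 - (2 : ℂ) • P) ∈ cellDomain e J := by
      rw [hPdef, ← cellPoint_projOp_zero]
      exact (isCellPair_projOp_zero e).isUnit_compress hP hPP
    exact (hlim.eventually ((isOpen_cellDomain e J).mem_nhds h1)).exists
  -- By `flow_mul_eq`, e^{tA}(1 - γ_t) = Q N⁻¹, so this operator has the same range as Q.
  set N := expOp e t - (2⁻¹ : ℂ) • (expOp e t - expOp e (-t)) * Q with hN
  have hNu : IsUnit N := by
    refine isUnit_of_injective fun v hv => ?_
    have h1 : expOp e (-t) (Q v) = 0 := by
      rw [← mul_apply_eq_comp, ← hflow t, mul_apply_eq_comp, hv, map_zero]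
    have h2 : Q v = 0 := by
      have : (expOp e t * expOp e (-t)) (Q v) = 0 := by rw [mul_apply_eq_comp, h1, map_zero]
      rwa [expOp_mul_neg] at this
    have h3 : expOp e t v = 0 := by
      rw [hN, sub_apply, mul_apply_eq_comp, h2, map_zero, sub_zero] at hv
      exact hv
    have : (expOp e (-t) * expOp e t) v = 0 := by rw [mul_apply_eq_comp, h3, map_zero]
    rwa [expOp_neg_mul] at this
  set T := expOp e t * (1 - γ t) with hT
  have hTQ : T = Q * Ring.inverse N := by
    have h1 : T * N = Q := by
      rw [hT, mul_assoc, hflow t, ← mul_assoc, expOp_mul_neg, one_mul]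
    rw [← h1, Ring.mul_inverse_cancel_right _ _ hNu]
  set Z := P * T * P + (1 - P) with hZ
  have hZu : IsUnit Z := by
    have h1 : Z = (expOp e t * P + (1 - P)) * (P * (1 - γ t) * P + (1 - P)) := by
      have h2 : (expOp e t * P + (1 - P)) * (P * (1 - γ t) * P + (1 - P)) =
          expOp e t * (P * P) * (1 - γ t) * P + expOp e t * (P * (1 - P)) +
            (((1 - P) * P) * (1 - γ t) * P + (1 - P) * (1 - P)) := by
        simp only [add_mul, mul_add, mul_assoc]
        abel
      rw [h2, hPP, hPP0, hPP1, hPP2, hZ, hT, ← mul_assoc P, hPdef, projOp_expOp]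
      simp
    have h3 : ∀ s, (expOp e s * P + (1 - P)) * (expOp e (-s) * P + (1 - P)) = 1 := by
      intro s
      have h4 : expOp e s * P * (expOp e (-s) * P) = P := by
        have : P * expOp e (-s) = expOp e (-s) * P := projOp_expOp e J (-s)
        rw [mul_assoc, ← mul_assoc P, this, mul_assoc, hPP, ← mul_assoc, expOp_mul_neg, one_mul]
      have h5 : (1 - P) * (expOp e (-s) * P) = 0 := by
        have : P * expOp e (-s) = expOp e (-s) * P := projOp_expOp e J (-s)
        rw [← this, ← mul_assoc, hPP1, zero_mul]
      rw [add_mul, mul_add, mul_add, h4, h5, hPP2, mul_assoc, hPP0, mul_zero]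
      abel
    rw [h1]
    have h6 := h3 t
    exact IsUnit.mul ⟨⟨_, _, h6, mul_eq_one_swap h6⟩, rfl⟩ ht
  set G := Ring.inverse Z with hG
  have hZG : Z * G = 1 := Ring.mul_inverse_cancel _ hZu
  have hGZ : G * Z = 1 := Ring.inverse_mul_cancel _ hZu
  have hZP : Z * P = P * T * P := by rw [hZ, add_mul, hPP1, add_zero, mul_assoc, hPP]
  have hPZ : P * Z = P * T * P := by
    rw [hZ, mul_add, hPP0, add_zero, mul_assoc P T P, ← mul_assoc, hPP]
  have hPG : P * G = G * P := by
    calc P * G = G * (Z * P) * G := by rw [← mul_assoc, hGZ, one_mul]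
      _ = G * P := by rw [hZP, ← hPZ, mul_assoc, mul_assoc, hZG, mul_one]
  have hG1 : (1 - P) * G = 1 - P := by
    have h1 : (1 - P) * Z = 1 - P := by rw [sub_mul, one_mul, hPZ, hZ]; abel
    conv_lhs => rw [← h1]
    rw [mul_assoc, hZG, mul_one]
  -- T P has its columns in the range of Q; multiplying by the inverse of its compression makes the
  -- pivot block the identity.
  set B := T * P * G with hB
  have hPB : P * B = P := by
    have h1 : P * B = (Z - (1 - P)) * G := by
      rw [hB, hZ, add_sub_cancel_right]; simp only [mul_assoc]
    rw [h1, sub_mul, hZG, hG1, sub_sub_cancel]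
  have hBP : B * P = B := by rw [hB, mul_assoc, ← hPG, ← mul_assoc, mul_assoc T, hPP]
  have hBQ : B = Q * (Ring.inverse N * P * G) := by
    rw [hB, hTQ]; simp only [mul_assoc]
  have hpiv : ∀ a ∈ J, ∀ i ∈ J, entry e a i B = if a = i then 1 else 0 := by
    intro a ha i _
    have h1 := congrArg (entry e a i) hPB
    rw [hPdef, entry_projOp_mul, if_pos ha, entry_projOp] at h1
    simpa [ha] using h1
  have hE : IsEchelon e J B := by
    refine ⟨fun a i hi => ?_, hpiv, fun i hi a hia => ?_⟩
    · rw [← hBP, hPdef, entry_mul_projOp, if_neg hi]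
    · by_contra h
      rw [hBQ] at h
      obtain ⟨l', hl', hal, h'⟩ := hlead _ _ _ h
      rw [← hBQ, hpiv l' hl' i hi, if_neg (hia.trans_le hal).ne'] at h'
      exact h' rfl
  -- The columns of Q - BQ lie in the range of Q and are killed by P, hence vanish.
  have hBQ1 : Q = B * Q := by
    have h1 : Q * (1 - Ring.inverse N * P * G * Q) = Q - B * Q := by
      rw [mul_sub, mul_one, ← mul_assoc, ← hBQ]
    have h2 := hzero (1 - Ring.inverse N * P * G * Q) (by
      rw [h1, mul_sub, ← mul_assoc, hPB, sub_self])
    rw [h1, sub_eq_zero] at h2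
    exact h2
  have hU : 1 - Q ∈ unitary (E →L[ℂ] E) := by rw [hQ, sub_sub_cancel]; exact hγ 0
  -- Unitarity puts the range of Q^* inside that of Q, so B also fixes Q^*; taking adjoints gives Q
  -- = Q B^*.
  have hQs : star Q = Q * (star Q - 1) := by
    have h1 := Unitary.mul_star_self_of_mem hU
    rw [star_sub, star_one, mul_sub, mul_one, sub_mul, one_mul] at h1
    have h2 : (1 : E →L[ℂ] E) - Q - (star Q - Q * star Q) = 1 - (star Q - (Q * star Q - Q)) := by
      abel
    rw [h2, sub_eq_self, sub_eq_zero] at h1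
    rw [mul_sub, mul_one]
    exact h1
  have hBQ2 : Q = Q * star B := by
    have h1 : star Q = B * star Q := by
      calc star Q = B * Q * (star Q - 1) := by rw [← hBQ1]; exact hQs
        _ = B * star Q := by rw [mul_assoc, ← hQs]
    have h2 := congrArg star h1
    rwa [star_mul, star_star] at h2
  have hPBs : P * star B = star B := by
    conv_lhs => rw [← hP]
    rw [← star_mul, hBP]
  have hQB : Q = B * (P * Q * P) * star B := by
    have : B * (P * Q * P) * star B = (B * P) * Q * (P * star B) := by simp only [mul_assoc]
    rw [this, hBP, hPBs, ← hBQ1, ← hBQ2]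
  -- Since Q B^* = Q and Q N⁻¹ = T, the compression of Q is a left factor of the invertible Z.
  have hu : IsUnit (P * Q * P + (1 - P)) := by
    have h1 : (P * Q * P + (1 - P)) * (P * star B * Ring.inverse N * P + (1 - P)) = Z := by
      have h2 : (P * Q * P + (1 - P)) * (P * star B * Ring.inverse N * P + (1 - P)) =
          P * Q * (P * P * star B) * Ring.inverse N * P + P * Q * (P * (1 - P)) +
            (((1 - P) * P) * star B * Ring.inverse N * P + (1 - P) * (1 - P)) := by
        simp only [add_mul, mul_add, mul_assoc]
        abel
      rw [h2, hPP, hPBs, hPP0, hPP1, hPP2, mul_assoc P Q, ← hBQ2, mul_assoc P, ← hTQ, hZ]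
      simp
    have h3 : (P * Q * P + (1 - P)) * ((P * star B * Ring.inverse N * P + (1 - P)) * G) = 1 := by
      rw [← mul_assoc, h1, hZG]
    exact ⟨⟨_, _, h3, mul_eq_one_swap h3⟩, rfl⟩
  obtain ⟨H, hH, hHU⟩ := exists_cellPoint_eq hP hPP hU hPB hBP hQB hu
  rw [mem_range_cellMap]
  exact ⟨B, H, hE, hH, by rw [hHU, hQ, sub_sub_cancel]⟩

end Backward

/-! ### The unstable manifolds -/

section Unstable

variable {E : Type*} [NormedAddCommGroup E] [InnerProductSpace ℂ E] [CompleteSpace E]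
  [FiniteDimensional ℂ E]

lemma finrank_line (F : CompleteFlag E) (i : Fin (Module.finrank ℂ E)) :
    Module.finrank ℂ (F.line (i + 1)) = 1 := by
  have h1 := Submodule.finrank_add_inf_finrank_orthogonal
    (F.antitone (Nat.le_succ (i : ℕ)) : F.W (i + 1) ≤ F.W i)
  have h2 := F.finrank_add i i.2.le
  have h3 := F.finrank_add (i + 1) i.2
  have h4 : F.line (i + 1) = (F.W (i + 1))ᗮ ⊓ F.W i := rfl
  rw [h4]
  omega

/-- An orthonormal basis which is adapted to the flag. -/
lemma exists_adapted_basis (F : CompleteFlag E) :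
    ∃ e : OrthonormalBasis (Fin (Module.finrank ℂ E)) ℂ E,
      ∀ i : Fin (Module.finrank ℂ E), F.line (i + 1) = Submodule.span ℂ {e i} := by
  have h1 : ∀ i : Fin (Module.finrank ℂ E), ∃ v : E, ‖v‖ = 1 ∧
      F.line (i + 1) = Submodule.span ℂ {v} := by
    intro i
    obtain ⟨⟨v, hv⟩, hv0, hspan⟩ := finrank_eq_one_iff'.1 (finrank_line F i)
    have hv0' : v ≠ 0 := fun h => hv0 (by simpa using h)
    have hc : ((‖v‖ : ℂ)⁻¹) ≠ 0 := by simpa using hv0'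
    refine ⟨(‖v‖ : ℂ)⁻¹ • v, ?_, ?_⟩
    · rw [norm_smul]; simp [hv0']
    · rw [Submodule.span_singleton_smul_eq hc.isUnit]
      refine le_antisymm (fun w hw => ?_) ((Submodule.span_singleton_le_iff_mem _ _).2 hv)
      obtain ⟨c, hc⟩ := hspan ⟨w, hw⟩
      exact Submodule.mem_span_singleton.2 ⟨c, congrArg Subtype.val hc⟩
  choose v hv1 hv2 using h1
  have hmem : ∀ i : Fin (Module.finrank ℂ E), v i ∈ F.line (i + 1) := fun i => by
    rw [hv2]; exact Submodule.mem_span_singleton_self _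
  have hlt : ∀ i j : Fin (Module.finrank ℂ E), i < j → ⟪v i, v j⟫ = 0 := by
    intro i j hij
    have h3 : v j ∈ F.W (i + 1) := 
      F.antitone (Nat.succ_le_of_lt (Fin.lt_def.1 hij)) (hmem j).2
    exact Submodule.inner_left_of_mem_orthogonal h3 (hmem i).1
  have hon : Orthonormal ℂ v := by
    refine ⟨hv1, fun i j hij => ?_⟩
    rcases lt_or_gt_of_ne hij with h | h
    · exact hlt i j h
    · exact inner_eq_zero_symm.1 (hlt j i h)
  obtain ⟨e, he⟩ := Orthonormal.exists_orthonormalBasis_extension_of_card_eq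
    (ι := Fin (Module.finrank ℂ E)) (by simp) (v := v) (s := Set.univ)
    (hon.comp _ Subtype.val_injective)
  exact ⟨e, fun i => by rw [he i (Set.mem_univ i), hv2]⟩

/-- The basis vectors whose lines have their index in `I`. -/
def indexSet (n : ℕ) (I : Finset ℕ) : Finset (Fin n) := Finset.univ.filter fun i => (i : ℕ) + 1 ∈ I

lemma sum_indexSet {β : Type*} [AddCommMonoid β] {n : ℕ} {I : Finset ℕ} (hI : I ⊆ Finset.Icc 1 n)
    (f : ℕ → β) : ∑ i ∈ I, f i = ∑ i ∈ indexSet n I, f ((i : ℕ) + 1) := by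
  have h1 : I = (indexSet n I).map ⟨fun i : Fin n => (i : ℕ) + 1, fun i j h => by
      simpa [Fin.ext_iff] using h⟩ := by
    ext a
    simp only [indexSet, Finset.mem_map, Finset.mem_filter, Finset.mem_univ, true_and]
    constructor
    · intro ha
      have := Finset.mem_Icc.1 (hI ha)
      exact ⟨⟨a - 1, by omega⟩, by simpa [Nat.sub_add_cancel this.1] using ha,
        Nat.sub_add_cancel this.1⟩
    · rintro ⟨i, hi, rfl⟩
      exact hi
  conv_lhs => rw [h1, Finset.sum_map]
  rfl

lemma starProjection_of_eq_span {K : Submodule ℂ E} {v : E} (h : K = Submodule.span ℂ {v})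
    (hv : ‖v‖ = 1) (w : E) : K.starProjection w = ⟪v, w⟫ • v := by
  subst h
  exact Submodule.starProjection_unit_singleton ℂ hv w

variable {F : CompleteFlag E} {e : OrthonormalBasis (Fin (Module.finrank ℂ E)) ℂ E}

lemma sum_smul_starProjection
    (he : ∀ i : Fin (Module.finrank ℂ E), F.line (i + 1) = Submodule.span ℂ {e i})
    {I : Finset ℕ} (hI : I ⊆ Finset.Icc 1 (Module.finrank ℂ E)) (c : ℕ → ℂ) :
    ∑ i ∈ I, c i • (F.line i).starProjection =
      diagOp e fun i => if i ∈ indexSet (Module.finrank ℂ E) I then c (i + 1) else 0 := by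
  rw [sum_indexSet hI fun i => c i • (F.line i).starProjection]
  refine ext_entry (e := e) fun a b => ?_
  have h1 : ∀ i, entry e a b (F.line ((i : Fin (Module.finrank ℂ E)) + 1)).starProjection =
      (if i = b then 1 else 0) * (if a = i then 1 else 0) := fun i => by
    rw [entry_apply, starProjection_of_eq_span (he i) (e.orthonormal.1 i), inner_smul_right,
      orthonormal_iff_ite.1 e.orthonormal, orthonormal_iff_ite.1 e.orthonormal]
  rw [map_sum, entry_diagOp]
  simp only [map_smul, h1, smul_eq_mul]
  by_cases hab : a = b
  · subst hab
    by_cases ha : a ∈ indexSet (Module.finrank ℂ E) I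
    · rw [Finset.sum_eq_single a]
      · simp [ha]
      · intro i _ hi; simp [hi]
      · exact fun h => absurd ha h
    · rw [Finset.sum_eq_zero]
      · simp [ha]
      · intro i hi
        have : i ≠ a := fun h => ha (h ▸ hi)
        simp [this]
  · rw [if_neg hab]
    refine Finset.sum_eq_zero fun i _ => ?_
    by_cases hi : i = b
    · have : a ≠ i := fun h => hab (h.trans hi)
      simp [this]
    · simp [hi]

lemma CompleteFlag.A_eq_weightOp
    (he : ∀ i : Fin (Module.finrank ℂ E), F.line (i + 1) = Submodule.span ℂ {e i}) :
    F.A = weightOp e := by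
  rw [CompleteFlag.A, sum_smul_starProjection he subset_rfl fun i => (i : ℂ), weightOp]
  congr 1
  ext i
  have : i ∈ indexSet (Module.finrank ℂ E) (Finset.Icc 1 (Module.finrank ℂ E)) := by
    simp [indexSet]
  rw [if_pos this]
  push_cast
  rfl

lemma CompleteFlag.critPoint_eq
    (he : ∀ i : Fin (Module.finrank ℂ E), F.line (i + 1) = Submodule.span ℂ {e i})
    {I : Finset ℕ} (hI : I ⊆ Finset.Icc 1 (Module.finrank ℂ E)) :
    F.critPoint I = 1 - (2 : ℂ) • projOp e (indexSet (Module.finrank ℂ E) I) := by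
  have := sum_smul_starProjection he hI fun _ => 1
  simp only [one_smul] at this
  rw [CompleteFlag.critPoint, this, projOp]

lemma CompleteFlag.unstableManifold_eq
    (he : ∀ i : Fin (Module.finrank ℂ E), F.line (i + 1) = Submodule.span ℂ {e i})
    {I : Finset ℕ} (hI : I ⊆ Finset.Icc 1 (Module.finrank ℂ E)) :
    F.unstableManifold I = Set.range (cellMap e (indexSet (Module.finrank ℂ E) I)) := by
  ext U
  simp only [CompleteFlag.unstableManifold, CompleteFlag.field, Set.mem_ofPred_eq,
    CompleteFlag.A_eq_weightOp he, CompleteFlag.critPoint_eq he hI]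
  constructor
  · rintro ⟨γ, hγ, hd, rfl, hlim⟩
    exact mem_range_cellMap_of_flowLine e hγ hd hlim
  · intro hU
    obtain ⟨B, H, hB, h, rfl⟩ := (mem_range_cellMap e).1 hU
    exact exists_flowLine e hB h

/-- Row i of B is zero when i lies beyond all pivots, so B^* e_i = 0 and 1 - U kills e_i. -/
lemma mem_unitary_of_mem_range_cellMap {n : ℕ} {e : OrthonormalBasis (Fin n) ℂ E}
    {J : Finset (Fin n)} {U : E →L[ℂ] E} (hU : U ∈ Set.range (cellMap e J)) :
    U ∈ unitary (E →L[ℂ] E) ∧ ∀ i, (∀ j ∈ J, j < i) → U (e i) = e i := by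
  obtain ⟨B, H, hB, h, rfl⟩ := (mem_range_cellMap e).1 hU
  refine ⟨h.cellPoint_mem_unitary (star_projOp e J) (projOp_mul_self e J), fun i hi => ?_⟩
  have h1 : star B (e i) = 0 := by
    refine e.toBasis.ext_elem fun l => ?_
    have h2 : entry e l i (star B) = 0 := by
      rw [entry_star]
      by_cases hl : l ∈ J
      · rw [hB.upper l hl i (hi l hl), star_zero]
      · rw [hB.col i l hl, star_zero]
    rw [entry_apply] at h2
    simpa [OrthonormalBasis.repr_apply_apply] using h2
  rw [cellPoint, sub_apply, mul_apply_eq_comp, h1, map_zero, sub_zero]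
  rfl

/-- If the dimension of the cell is the degree of `Tc_k`, then the indices up to the largest element
of `J` are fewer than `k`. -/
lemma card_filter_le_lt {n k : ℕ} (hk : 1 ≤ k) (J : Finset (Fin n))
    (hJ : ∀ m : Fin n, J = {m} → (m : ℕ) + 1 ≠ k)
    (hd : ∑ i ∈ J, (2 * (i : ℕ) + 1) = 2 * k - 1) :
    (Finset.univ.filter fun i => ∃ j ∈ J, i ≤ j).card < k := by
  rcases J.eq_empty_or_nonempty with rfl | hne
  · simp; omega
  obtain ⟨m, hm, hmax⟩ := J.exists_max_image id hne
  have hsub : (Finset.univ.filter fun i => ∃ j ∈ J, i ≤ j) ⊆ Finset.Iic m := by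
    intro i hi
    obtain ⟨j, hj, hij⟩ := (Finset.mem_filter.1 hi).2
    exact Finset.mem_Iic.2 (hij.trans (hmax j hj))
  refine (Finset.card_le_card hsub).trans_lt ?_
  rw [Fin.card_Iic]
  -- For J = {m} the dimension gives m + 1 = k, which is excluded. A second pivot adds at least 1,
  -- so 2m + 1 < 2k - 1.
  by_cases h : J = {m}
  · have h1 := hJ m h
    rw [h, Finset.sum_singleton] at hd
    omega
  · obtain ⟨j, hj, hjm⟩ : ∃ j ∈ J, j ≠ m := by
      by_contra! hcon
      exact h (Finset.eq_singleton_iff_unique_mem.2 ⟨hm, hcon⟩)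
    have h1 : ∑ i ∈ ({m, j} : Finset (Fin n)), (2 * (i : ℕ) + 1) ≤
        ∑ i ∈ J, (2 * (i : ℕ) + 1) :=
      Finset.sum_le_sum_of_subset (by
        intro x hx
        rcases Finset.mem_insert.1 hx with rfl | hx
        · exact hm
        · rwa [Finset.mem_singleton.1 hx])
    rw [Finset.sum_pair hjm.symm, hd] at h1
    omega

end Unstable

end UnstableIntegral

end

/-! ### The main theorem -/

theorem mainTheorem8 {E : Type*} [NormedAddCommGroup E] [InnerProductSpace ℂ E] [CompleteSpace E]
    [FiniteDimensional ℂ E] (F : UnstableIntegral.CompleteFlag E)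
    (k : ℕ) (hk : 1 ≤ k) (hkn : k ≤ Module.finrank ℂ E)
    (I : Finset ℕ) (hI : I ⊆ Finset.Icc 1 (Module.finrank ℂ E)) (hIk : I ≠ {k}) :
    Nonempty (UnstableIntegral.OrientedAtlas (F.unstableManifold I) (∑ i ∈ I, (2 * i - 1))) ∧
    ∀ o : UnstableIntegral.OrientedAtlas (F.unstableManifold I) (∑ i ∈ I, (2 * i - 1)),
      UnstableIntegral.HasFormIntegral o (UnstableIntegral.Tc E k) 0 := by
  open UnstableIntegral in
  obtain ⟨e, he⟩ := exists_adapted_basis F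
  have hM := CompleteFlag.unstableManifold_eq he hI
  set J := indexSet (Module.finrank ℂ E) I with hJ
  have hd : ∑ i ∈ I, (2 * i - 1) = ∑ i ∈ J, (2 * (i : ℕ) + 1) := by
    rw [sum_indexSet hI fun i => 2 * i - 1]
    exact Finset.sum_congr rfl fun i _ => by omega
  rw [hM]
  refine ⟨nonempty_orientedAtlas_range_cellMap e J hd, fun o => ?_⟩
  have : SecondCountableTopology (E →L[ℂ] E) := by
    have : FiniteDimensional ℝ (E →L[ℂ] E) := FiniteDimensional.complexToReal (E →L[ℂ] E)
    have := FiniteDimensional.proper ℝ (E →L[ℂ] E)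
    exact secondCountable_of_proper
  -- The set of rows is the whole initial segment up to the largest pivot: below that pivot B may
  -- have nonzero rows outside J.
  refine hasFormIntegral_zero ⟨_, Set.mem_range_self 0⟩ o _ fun f x hx =>
    pullbackCoeff_Tc_eq_zero e (Finset.univ.filter fun i => ∃ j ∈ J, i ≤ j) (fun U hU => ?_)
      (fun hdk => card_filter_le_lt hk J (fun m hm hmk => ?_) (hd ▸ hdk)) f hx
  · obtain ⟨h1, h2⟩ := mem_unitary_of_mem_range_cellMap hU
    refine ⟨h1, fun i hi => h2 i fun j hj => ?_⟩
    by_contra h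
    exact hi (Finset.mem_filter.2 ⟨Finset.mem_univ i, j, hj, not_lt.1 h⟩)
  · refine hIk (Finset.ext fun a => ?_)
    constructor
    · intro ha
      have h1 := Finset.mem_Icc.1 (hI ha)
      have h2 : (⟨a - 1, by omega⟩ : Fin (Module.finrank ℂ E)) ∈ J := by
        rw [hJ, indexSet, Finset.mem_filter]
        exact ⟨Finset.mem_univ _, by simpa [Nat.sub_add_cancel h1.1] using ha⟩
      rw [hm, Finset.mem_singleton] at h2
      rw [Finset.mem_singleton, ← hmk, ← h2]
      exact (Nat.sub_add_cancel h1.1).symm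
    · intro ha
      have h2 : m ∈ J := hm ▸ Finset.mem_singleton_self m
      rw [Finset.mem_singleton.1 ha, ← hmk]
      exact (Finset.mem_filter.1 h2).2
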